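/- Let $\mathbb K=\mathbb R$ or $\mathbb C$, let $U\subseteq\mathbb K^3$ be open and connected (coordinates $(x,y,u)$), and let $W\subseteq\mathbb K^4$ be open (coordinates $(x,y,u,u_1)$) with $(x,y,u,0)\in W$ for all $(x,y,u)\in U$. Let $F_1,F_2:U\to\mathbb K$ and $F_3,G:W\to\mathbb K$ be analytic, with $F_2\neq 0$ everywhere on $U$, and consider for $u=u(x,y)$ the system $$(S)\qquad u_y=F,\quad F:=F_1(x,y,u)\,u_x+F_2(x,y,u)\,u_x^2+F_3(x,y,u,u_x)\,u_x^3,\qquad u_{xxx}=G(x,y,u,u_x).$$ Write $u_1,u_2,u_{11},u_{12},\dots$ for the jet coordinates corresponding to $u_x,u_y,u_{xx},u_{xy},\dots$, and $D_x,D_y$ for the total derivatives. For a vector field $V=\xi\,\partial_x+\tau\,\partial_y+\phi\,\partial_u$ on $U$ let $\mathrm{Pr}^{(3)}V$ be its third prolongation to the space of 3-jets, i.e. the vector field with components $\xi,\tau,\phi$ and $\phi^{J}$ ($1\le|J|\le 3$), where $\phi^{J,i}=D_i\phi^J-u_{J,1}D_i\xi-u_{J,2}D_i\tau$. An *infinitesimal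 Lie symmetry* of $(S)$ is a vector field $V$ on $U$ with $C^\infty$ coefficients $\xi,\tau,\phi$ of $(x,y,u)$ (holomorphic if $\mathbb K=\mathbb C$) such that $$\mathrm{Pr}^{(3)}V(u_2-F)=0\quad\text{and}\quad \mathrm{Pr}^{(3)}V(u_{111}-G)=0$$ at every 3-jet with $(x,y,u)\in U$, $(x,y,u,u_1)\in W$ that satisfies $u_2=F$, $u_{111}=G$ and the equations obtained from $u_2=F$ by one or two total differentiations. The infinitesimal Lie symmetries form a $\mathbb K$-vector space, the Lie symmetry algebra of $(S)$. **Theorem.** Let $z_0\in U$. Any infinitesimal Lie symmetry $V=\xi\,\partial_x+\tau\,\partial_y+\phi\,\partial_u$ of $(S)$ is uniquely determined on $U$ by the ten values $$\big(\xi,\ \tau,\ \phi,\ \xi_x,\ \tau_x,\ \phi_x,\ \phi_u,\ \xi_{xx},\ \tau_{xx},\ \phi_{xx}\big)(z_0):$$ two infinitesimal Lie symmetries with the same ten values at $z_0$ coincide on $U$. Consequently the Lie symmetry algebra of $(S)$ has dimension at most $10$ over $\mathbb K$. -/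

import Mathlib

open scoped ContDiff

namespace LieSymmetry

/-- The space of the variables `(x, y, u)`: two independent and one dependent variable. -/
abbrev Pt (𝕜 : Type*) := 𝕜 × 𝕜 × 𝕜

/-- Names of the coordinates of the third jet space of functions `u = u(x, y)`
(index `1` stands for a derivative in `x`, index `2` for a derivative in `y`). -/
inductive Coord
  | x | y | u | u1 | u2 | u11 | u12 | u22 | u111 | u112 | u122 | u222
  deriving DecidableEq

instance : Fintype Coord :=
  ⟨{.x, .y, .u, .u1, .u2, .u11, .u12, .u22, .u111, .u112, .u122, .u222}, fun c => by
    cases c <;> simp⟩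

/-- The third jet space. -/
abbrev Jet (𝕜 : Type*) := Coord → 𝕜

/-- The data of the system
`u_y = F1(x,y,u) u_x + F2(x,y,u) u_x² + F3(x,y,u,u_x) u_x³`, `u_xxx = G(x,y,u,u_x)`,
with `F1`, `F2` considered on `U` and `F3`, `G` considered on `W`. -/
structure System (𝕜 : Type*) where
  U : Set (Pt 𝕜)
  W : Set (𝕜 × 𝕜 × 𝕜 × 𝕜)
  F1 : Pt 𝕜 → 𝕜
  F2 : Pt 𝕜 → 𝕜
  F3 : 𝕜 × 𝕜 × 𝕜 × 𝕜 → 𝕜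
  G : 𝕜 × 𝕜 × 𝕜 × 𝕜 → 𝕜

noncomputable section

variable {𝕜 : Type*} [RCLike 𝕜]

/-- The point `(x, y, u)` below a jet. -/
def base (j : Jet 𝕜) : Pt 𝕜 := (j .x, j .y, j .u)

/-- The point `(x, y, u, u_1)` below a jet. -/
def base1 (j : Jet 𝕜) : 𝕜 × 𝕜 × 𝕜 × 𝕜 := (j .x, j .y, j .u, j .u1)

/-- The vector field `∂_x + u_1 ∂_u + u_11 ∂_{u_1} + u_12 ∂_{u_2} + …`, cut off so that it
lives on the third jet space. It is only applied to functions of the second-order jet. -/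
def dirX (j : Jet 𝕜) : Jet 𝕜
  | .x => 1
  | .y => 0
  | .u => j .u1
  | .u1 => j .u11
  | .u2 => j .u12
  | .u11 => j .u111
  | .u12 => j .u112
  | .u22 => j .u122
  | _ => 0

/-- The vector field `∂_y + u_2 ∂_u + u_12 ∂_{u_1} + u_22 ∂_{u_2} + …`, cut off so that it
lives on the third jet space. It is only applied to functions of the second-order jet. -/
def dirY (j : Jet 𝕜) : Jet 𝕜
  | .x => 0
  | .y => 1
  | .u => j .u2
  | .u1 => j .u12
  | .u2 => j .u22
  | .u11 => j .u112
  | .u12 => j .u122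
  | .u22 => j .u222
  | _ => 0

/-- Derivative of a function along a vector field on the jet space: `along dirX` and
`along dirY` are the total derivatives `D_x` and `D_y` (for functions of order at most two). -/
def along (T : Jet 𝕜 → Jet 𝕜) (f : Jet 𝕜 → 𝕜) (j : Jet 𝕜) : 𝕜 := fderiv 𝕜 f j (T j)

/-- The three components of a vector field `V = ξ ∂_x + τ ∂_y + φ ∂_u`. -/
def xi (V : Pt 𝕜 → Pt 𝕜) (z : Pt 𝕜) : 𝕜 := (V z).1

def tau (V : Pt 𝕜 → Pt 𝕜) (z : Pt 𝕜) : 𝕜 := (V z).2.1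

def phi (V : Pt 𝕜 → Pt 𝕜) (z : Pt 𝕜) : 𝕜 := (V z).2.2

/-- One step of the prolongation formula,
`φ^{J,i} = D_i φ^J - u_{J,1} D_i ξ - u_{J,2} D_i τ`, where `T` is the direction `i`,
`f = φ^J`, `c1 = u_{J,1}` and `c2 = u_{J,2}`. -/
def prolStep (T : Jet 𝕜 → Jet 𝕜) (V : Pt 𝕜 → Pt 𝕜) (f : Jet 𝕜 → 𝕜) (c1 c2 : Coord)
    (j : Jet 𝕜) : 𝕜 :=
  along T f j - j c1 * along T (fun i => xi V (base i)) j
    - j c2 * along T (fun i => tau V (base i)) j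

def phi0 (V : Pt 𝕜 → Pt 𝕜) (j : Jet 𝕜) : 𝕜 := phi V (base j)

def phiX (V : Pt 𝕜 → Pt 𝕜) : Jet 𝕜 → 𝕜 := prolStep dirX V (phi0 V) .u1 .u2

def phiY (V : Pt 𝕜 → Pt 𝕜) : Jet 𝕜 → 𝕜 := prolStep dirY V (phi0 V) .u1 .u2

def phiXX (V : Pt 𝕜 → Pt 𝕜) : Jet 𝕜 → 𝕜 := prolStep dirX V (phiX V) .u11 .u12

def phiXY (V : Pt 𝕜 → Pt 𝕜) : Jet 𝕜 → 𝕜 := prolStep dirY V (phiX V) .u11 .u12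

def phiYY (V : Pt 𝕜 → Pt 𝕜) : Jet 𝕜 → 𝕜 := prolStep dirY V (phiY V) .u12 .u22

def phiXXX (V : Pt 𝕜 → Pt 𝕜) : Jet 𝕜 → 𝕜 := prolStep dirX V (phiXX V) .u111 .u112

def phiXXY (V : Pt 𝕜 → Pt 𝕜) : Jet 𝕜 → 𝕜 := prolStep dirY V (phiXX V) .u111 .u112

def phiXYY (V : Pt 𝕜 → Pt 𝕜) : Jet 𝕜 → 𝕜 := prolStep dirY V (phiXY V) .u112 .u122

def phiYYY (V : Pt 𝕜 → Pt 𝕜) : Jet 𝕜 → 𝕜 := prolStep dirY V (phiYY V) .u122 .u222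

/-- The third prolongation of `V`, a vector field on the third jet space. -/
def prolong (V : Pt 𝕜 → Pt 𝕜) (j : Jet 𝕜) : Jet 𝕜
  | .x => xi V (base j)
  | .y => tau V (base j)
  | .u => phi0 V j
  | .u1 => phiX V j
  | .u2 => phiY V j
  | .u11 => phiXX V j
  | .u12 => phiXY V j
  | .u22 => phiYY V j
  | .u111 => phiXXX V j
  | .u112 => phiXXY V j
  | .u122 => phiXYY V j
  | .u222 => phiYYY V j

namespace System

/-- The first equation, as a function on the jet space:
`u_2 - (F1 u_1 + F2 u_1² + F3 u_1³)`. -/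
def eq1 (S : System 𝕜) (j : Jet 𝕜) : 𝕜 :=
  j .u2 - (S.F1 (base j) * j .u1 + S.F2 (base j) * j .u1 ^ 2 + S.F3 (base1 j) * j .u1 ^ 3)

/-- The second equation, as a function on the jet space: `u_111 - G`. -/
def eq2 (S : System 𝕜) (j : Jet 𝕜) : 𝕜 := j .u111 - S.G (base1 j)

/-- The 3-jets (over the domain of the system) that satisfy the two equations and the total
derivatives of order at most two of the first equation. -/
def variety (S : System 𝕜) : Set (Jet 𝕜) :=
  {j | base j ∈ S.U ∧ base1 j ∈ S.W ∧
    S.eq1 j = 0 ∧ along dirX S.eq1 j = 0 ∧ along dirY S.eq1 j = 0 ∧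
    along dirX (along dirX S.eq1) j = 0 ∧ along dirX (along dirY S.eq1) j = 0 ∧
    along dirY (along dirY S.eq1) j = 0 ∧ S.eq2 j = 0}

/-- Infinitesimal Lie symmetries: smooth vector fields `ξ ∂_x + τ ∂_y + φ ∂_u` on `U` whose
third prolongation annihilates both equations along the system. -/
def IsSymmetry (S : System 𝕜) (V : Pt 𝕜 → Pt 𝕜) : Prop :=
  ContDiffOn 𝕜 ∞ V S.U ∧
    ∀ j ∈ S.variety, fderiv 𝕜 S.eq1 j (prolong V j) = 0 ∧ fderiv 𝕜 S.eq2 j (prolong V j) = 0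

end System

/-- Partial derivative in `x` of a function of `(x, y, u)`. -/
def partialX (f : Pt 𝕜 → 𝕜) (z : Pt 𝕜) : 𝕜 := fderiv 𝕜 f z (1, 0, 0)

/-- Partial derivative in `u` of a function of `(x, y, u)`. -/
def partialU (f : Pt 𝕜 → 𝕜) (z : Pt 𝕜) : 𝕜 := fderiv 𝕜 f z (0, 0, 1)

/-- The ten initial Taylor coefficients
`(ξ, τ, φ, ξ_x, τ_x, φ_x, φ_u, ξ_xx, τ_xx, φ_xx)` of `V` at a point. -/
def initialTaylorCoeffs (V : Pt 𝕜 → Pt 𝕜) (z : Pt 𝕜) : Fin 10 → 𝕜 :=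
  ![xi V z, tau V z, phi V z,
    partialX (xi V) z, partialX (tau V) z, partialX (phi V) z, partialU (phi V) z,
    partialX (partialX (xi V)) z, partialX (partialX (tau V)) z, partialX (partialX (phi V)) z]

/-! Linearity of the prolongation, needed for the vector space structure on symmetries. -/

/-- `h = a f + b g` on `O`, where `f` and `g` are smooth on `O`. -/
def Comb (O : Set (Jet 𝕜)) (a b : 𝕜) (f g h : Jet 𝕜 → 𝕜) : Prop :=
  ContDiffOn 𝕜 ∞ f O ∧ ContDiffOn 𝕜 ∞ g O ∧ ∀ j ∈ O, h j = a * f j + b * g j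

theorem contDiff_base : ContDiff 𝕜 ∞ (base : Jet 𝕜 → Pt 𝕜) := by
  unfold base; fun_prop

theorem contDiff_dirX : ContDiff 𝕜 ∞ (dirX : Jet 𝕜 → Jet 𝕜) := by
  rw [contDiff_pi]
  intro c
  cases c <;> simp only [dirX] <;> fun_prop

theorem contDiff_dirY : ContDiff 𝕜 ∞ (dirY : Jet 𝕜 → Jet 𝕜) := by
  rw [contDiff_pi]
  intro c
  cases c <;> simp only [dirY] <;> fun_prop

theorem contDiffOn_along {O : Set (Jet 𝕜)} (hO : IsOpen O) {T : Jet 𝕜 → Jet 𝕜}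
    (hT : ContDiff 𝕜 ∞ T) {f : Jet 𝕜 → 𝕜} (hf : ContDiffOn 𝕜 ∞ f O) :
    ContDiffOn 𝕜 ∞ (along T f) O :=
  (hf.fderiv_of_isOpen hO (by simp)).clm_apply hT.contDiffOn

theorem Comb.along {O : Set (Jet 𝕜)} (hO : IsOpen O) {T : Jet 𝕜 → Jet 𝕜}
    (hT : ContDiff 𝕜 ∞ T) {a b : 𝕜} {f g h : Jet 𝕜 → 𝕜} (H : Comb O a b f g h) :
    Comb O a b (along T f) (along T g) (along T h) := by
  obtain ⟨hf, hg, hh⟩ := H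
  refine ⟨contDiffOn_along hO hT hf, contDiffOn_along hO hT hg, fun j hj => ?_⟩
  have hn : O ∈ nhds j := hO.mem_nhds hj
  have e : h =ᶠ[nhds j] fun i => a * f i + b * g i := by
    filter_upwards [hn] with i hi using hh i hi
  have df : DifferentiableAt 𝕜 f j := (hf.contDiffAt hn).differentiableAt (by simp)
  have dg : DifferentiableAt 𝕜 g j := (hg.contDiffAt hn).differentiableAt (by simp)
  have := ((df.hasFDerivAt.const_mul a).add (dg.hasFDerivAt.const_mul b)).congr_of_eventuallyEq e
  simp [LieSymmetry.along, this.fderiv]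

theorem Comb.prolStep {O : Set (Jet 𝕜)} (hO : IsOpen O) {T : Jet 𝕜 → Jet 𝕜}
    (hT : ContDiff 𝕜 ∞ T) {a b : 𝕜} {V₁ V₂ V : Pt 𝕜 → Pt 𝕜}
    (hx : Comb O a b (fun i => xi V₁ (base i)) (fun i => xi V₂ (base i)) (fun i => xi V (base i)))
    (ht : Comb O a b (fun i => tau V₁ (base i)) (fun i => tau V₂ (base i))
      (fun i => tau V (base i)))
    {f g h : Jet 𝕜 → 𝕜} (H : Comb O a b f g h) (c1 c2 : Coord) :
    Comb O a b (prolStep T V₁ f c1 c2) (prolStep T V₂ g c1 c2) (prolStep T V h c1 c2) := by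
  obtain ⟨x1, x2, x3⟩ := hx.along hO hT
  obtain ⟨t1, t2, t3⟩ := ht.along hO hT
  obtain ⟨f1, f2, f3⟩ := H.along hO hT
  have p : ∀ c : Coord, ContDiffOn 𝕜 ∞ (fun i : Jet 𝕜 => i c) O := fun c => by fun_prop
  refine ⟨(f1.sub ((p c1).mul x1)).sub ((p c2).mul t1),
    (f2.sub ((p c1).mul x2)).sub ((p c2).mul t2), fun j hj => ?_⟩
  simp only [LieSymmetry.prolStep, x3 j hj, t3 j hj, f3 j hj]
  ring

theorem prolong_comb {U : Set (Pt 𝕜)} (hU : IsOpen U) {V₁ V₂ : Pt 𝕜 → Pt 𝕜}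
    (h₁ : ContDiffOn 𝕜 ∞ V₁ U) (h₂ : ContDiffOn 𝕜 ∞ V₂ U) (a b : 𝕜) {j : Jet 𝕜}
    (hj : base j ∈ U) :
    prolong (fun z => a • V₁ z + b • V₂ z) j = a • prolong V₁ j + b • prolong V₂ j := by
  have hO : IsOpen (base ⁻¹' U : Set (Jet 𝕜)) := hU.preimage contDiff_base.continuous
  have m : Set.MapsTo (base : Jet 𝕜 → Pt 𝕜) (base ⁻¹' U) U := fun _ h => h
  have c₁ := h₁.comp contDiff_base.contDiffOn m
  have c₂ := h₂.comp contDiff_base.contDiffOn m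
  have hx : Comb (base ⁻¹' U) a b (fun i => xi V₁ (base i)) (fun i => xi V₂ (base i))
      (fun i => xi (fun z => a • V₁ z + b • V₂ z) (base i)) :=
    ⟨c₁.fst, c₂.fst, fun _ _ => by simp [xi]⟩
  have ht : Comb (base ⁻¹' U) a b (fun i => tau V₁ (base i)) (fun i => tau V₂ (base i))
      (fun i => tau (fun z => a • V₁ z + b • V₂ z) (base i)) :=
    ⟨c₁.snd.fst, c₂.snd.fst, fun _ _ => by simp [tau]⟩
  have h0 : Comb (base ⁻¹' U) a b (phi0 V₁) (phi0 V₂)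
      (phi0 (fun z => a • V₁ z + b • V₂ z)) :=
    ⟨c₁.snd.snd, c₂.snd.snd, fun _ _ => by simp [phi0, phi]⟩
  have hX := Comb.prolStep hO contDiff_dirX hx ht h0 .u1 .u2
  have hY := Comb.prolStep hO contDiff_dirY hx ht h0 .u1 .u2
  have hXX := Comb.prolStep hO contDiff_dirX hx ht hX .u11 .u12
  have hXY := Comb.prolStep hO contDiff_dirY hx ht hX .u11 .u12
  have hYY := Comb.prolStep hO contDiff_dirY hx ht hY .u12 .u22
  have hXXX := Comb.prolStep hO contDiff_dirX hx ht hXX .u111 .u112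
  have hXXY := Comb.prolStep hO contDiff_dirY hx ht hXX .u111 .u112
  have hXYY := Comb.prolStep hO contDiff_dirY hx ht hXY .u112 .u122
  have hYYY := Comb.prolStep hO contDiff_dirY hx ht hYY .u122 .u222
  funext c
  cases c
  · exact hx.2.2 j hj
  · exact ht.2.2 j hj
  · exact h0.2.2 j hj
  · exact hX.2.2 j hj
  · exact hY.2.2 j hj
  · exact hXX.2.2 j hj
  · exact hXY.2.2 j hj
  · exact hYY.2.2 j hj
  · exact hXXX.2.2 j hj
  · exact hXXY.2.2 j hj
  · exact hXYY.2.2 j hj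
  · exact hYYY.2.2 j hj

namespace System

theorem IsSymmetry.comb {S : System 𝕜} (hU : IsOpen S.U) {V₁ V₂ : Pt 𝕜 → Pt 𝕜}
    (h₁ : S.IsSymmetry V₁) (h₂ : S.IsSymmetry V₂) (a b : 𝕜) :
    S.IsSymmetry (fun z => a • V₁ z + b • V₂ z) := by
  refine ⟨(h₁.1.const_smul a).add (h₂.1.const_smul b), fun j hj => ?_⟩
  rw [prolong_comb hU h₁.1 h₂.1 a b hj.1]
  simp [h₁.2 j hj, h₂.2 j hj]

theorem isSymmetry_zero {S : System 𝕜} (hU : IsOpen S.U) : S.IsSymmetry (fun _ => 0) := by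
  have h0 : ContDiffOn 𝕜 ∞ (fun _ => 0 : Pt 𝕜 → Pt 𝕜) S.U := contDiffOn_const
  refine ⟨h0, fun j hj => ?_⟩
  have := prolong_comb hU h0 h0 0 0 hj.1
  simp only [smul_zero, add_zero, zero_smul] at this
  simp [this]

/-- The Lie symmetry algebra: the vector space of all infinitesimal Lie symmetries, as
vector fields on `U` (functions on the subtype `U`, so that two symmetries are equal exactly
when they agree on `U`). -/
def symmetryAlgebra (S : System 𝕜) (hU : IsOpen S.U) : Submodule 𝕜 (S.U → Pt 𝕜) where
  carrier := {v | ∃ V, S.IsSymmetry V ∧ ∀ z : S.U, v z = V z}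
  zero_mem' := ⟨_, isSymmetry_zero hU, fun _ => rfl⟩
  add_mem' := by
    rintro v w ⟨V, hV, hv⟩ ⟨W, hW, hw⟩
    exact ⟨_, hV.comb hU hW 1 1, fun z => by simp [hv z, hw z]⟩
  smul_mem' := by
    rintro a v ⟨V, hV, hv⟩
    exact ⟨_, hV.comb hU hV a 0, fun z => by simp [hv z]⟩

end System

end

end LieSymmetry

/-! The invariance conditions are identities in the jet coordinates that remain free on the system:
in `x, y, u, p = u_1` for the first equation, and in `r = u_11` as well for the second, which is
quadratic in `r`. Let `f1, f2, f3` be the first three derivatives of `F` in `p` at `p = 0`. Taking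
the coefficients of the powers of `r` and then of the low powers of `p` gives linear differential
equations for `ξ, τ, φ` (`separated_first`, `separated_second`): formulas for `φ_y`, `ξ_y`, `f2
τ_y`, the relations `ξ_u + f1 τ_u + f2 τ_x = 0` and `2 f2 τ_u + f3 τ_x = 0`, and formulas for
`φ_xu`, `φ_uu`, `φ_xxx` and `3 φ_xxu`.

Since `f2 = 2 F2` has no zeros, every first derivative is a combination of the seven functions of
`frame1`, and every second derivative is a combination of the ten functions of `frame`; only `ξ_xx,
τ_xx, φ_xx` are new.

The crux is `inSpan_third`. Modulo combinations of `frame`, the two ways to compute `φ_xuu` give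
`ξ_xxu + f1 τ_xxu ≡ 3 (ξ_xxu + f1 τ_xxu) + f2 τ_xxx`, while differentiating the relation for `ξ_u`
twice in `x` gives `ξ_xxu + f1 τ_xxu ≡ - f2 τ_xxx`. Hence `f2 τ_xxx ≡ 0`. Likewise `φ_xxu ≡ ξ_xxx +
f1 τ_xxx ≡ 3 φ_xxu`, which yields `ξ_xxx ≡ 0`.

So the ten functions satisfy a closed linear first-order system with smooth coefficients
(`inSpan_partial_frame`). By Grönwall's inequality on segments and connectedness, a solution that
vanishes at one point vanishes on `U` (`eq_zero_of_inSpan_partial`). Evaluation of the ten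
coefficients at `z₀` is then an injective linear map into `𝕜¹⁰`. -/

namespace LieSymmetry

/-! ### Derivatives along vector fields, partial and total derivatives. -/

noncomputable section

variable {𝕜 : Type*} [RCLike 𝕜]
variable {E : Type*} [NormedAddCommGroup E] [NormedSpace 𝕜 E]

/-- On `O`, the function `f` is differentiable, with derivative `g` along the vector field `T`. -/
def HasAlongOn (T : E → E) (f g : E → 𝕜) (O : Set E) : Prop :=
  ∀ j ∈ O, DifferentiableAt 𝕜 f j ∧ fderiv 𝕜 f j (T j) = g j

namespace HasAlongOn

variable {T : E → E} {O : Set E} {f f' g g' : E → 𝕜}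

theorem add (hf : HasAlongOn T f f' O) (hg : HasAlongOn T g g' O) :
    HasAlongOn T (fun j => f j + g j) (fun j => f' j + g' j) O := fun j hj => by
  refine ⟨(hf j hj).1.add (hg j hj).1, ?_⟩
  rw [fderiv_fun_add (hf j hj).1 (hg j hj).1]
  simp [(hf j hj).2, (hg j hj).2]

theorem sub (hf : HasAlongOn T f f' O) (hg : HasAlongOn T g g' O) :
    HasAlongOn T (fun j => f j - g j) (fun j => f' j - g' j) O := fun j hj => by
  refine ⟨(hf j hj).1.sub (hg j hj).1, ?_⟩
  rw [fderiv_fun_sub (hf j hj).1 (hg j hj).1]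
  simp [(hf j hj).2, (hg j hj).2]

theorem mul (hf : HasAlongOn T f f' O) (hg : HasAlongOn T g g' O) :
    HasAlongOn T (fun j => f j * g j) (fun j => f' j * g j + f j * g' j) O := fun j hj => by
  refine ⟨(hf j hj).1.mul (hg j hj).1, ?_⟩
  rw [fderiv_fun_mul (hf j hj).1 (hg j hj).1]
  simp [(hf j hj).2, (hg j hj).2]
  ring

theorem const (c : 𝕜) : HasAlongOn T (fun _ => c) (fun _ => 0) O := fun j _ => by
  simp

theorem congr (hO : IsOpen O) (hf : HasAlongOn T f f' O) (hg : ∀ j ∈ O, g j = f j)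
    (hg' : ∀ j ∈ O, g' j = f' j) : HasAlongOn T g g' O := fun j hj => by
  have e : g =ᶠ[nhds j] f := by
    filter_upwards [hO.mem_nhds hj] with i hi using hg i hi
  exact ⟨(hf j hj).1.congr_of_eventuallyEq e, by rw [e.fderiv_eq, (hf j hj).2, hg' j hj]⟩

theorem congr_right (hf : HasAlongOn T f f' O) (hg' : ∀ j ∈ O, g' j = f' j) :
    HasAlongOn T f g' O := fun j hj => ⟨(hf j hj).1, by rw [(hf j hj).2, hg' j hj]⟩

theorem congr_of_eq (hf : HasAlongOn T f f' O) (hg : ∀ j, g j = f j)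
    (hg' : ∀ j ∈ O, g' j = f' j) : HasAlongOn T g g' O :=
  (funext hg : g = f) ▸ hf.congr_right hg'

end HasAlongOn

/-- Directional derivative along a constant vector. -/
def pd (v : E) (f : E → 𝕜) (z : E) : 𝕜 := fderiv 𝕜 f z v

theorem ContDiffOn.pd {O : Set E} (hO : IsOpen O) {f : E → 𝕜} (hf : ContDiffOn 𝕜 ∞ f O) (v : E) :
    ContDiffOn 𝕜 ∞ (pd v f) O :=
  (hf.fderiv_of_isOpen hO (by simp)).clm_apply contDiffOn_const

theorem differentiableAt_of_contDiffOn {O : Set E} (hO : IsOpen O) {f : E → 𝕜}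
    (hf : ContDiffOn 𝕜 ∞ f O) {z : E} (hz : z ∈ O) : DifferentiableAt 𝕜 f z :=
  (hf.contDiffAt (hO.mem_nhds hz)).differentiableAt (by simp)

theorem hasAlongOn_pd {O : Set E} (hO : IsOpen O) {f : E → 𝕜} (hf : ContDiffOn 𝕜 ∞ f O) (v : E) :
    HasAlongOn (fun _ => v) f (pd v f) O := fun _ hz =>
  ⟨differentiableAt_of_contDiffOn hO hf hz, rfl⟩

theorem pd_comm {O : Set E} (hO : IsOpen O) {f : E → 𝕜} (hf : ContDiffOn 𝕜 ∞ f O) (v w : E)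
    {z : E} (hz : z ∈ O) : pd v (pd w f) z = pd w (pd v f) z := by
  have hc := hf.contDiffAt (hO.mem_nhds hz)
  have hd : DifferentiableAt 𝕜 (fderiv 𝕜 f) z :=
    ((hf.fderiv_of_isOpen hO (m := ∞) (by simp)).contDiffAt (hO.mem_nhds hz)).differentiableAt
      (by simp)
  -- Over `ℝ` and `ℂ`, smoothness of order two is enough for a symmetric second derivative.
  have hs : IsSymmSndFDerivAt 𝕜 f z := hc.isSymmSndFDerivAt (by
    simpa using (WithTop.coe_le_coe.2 le_top : ((2 : ℕ∞) : WithTop ℕ∞) ≤ ∞))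
  have key : ∀ a b : E, pd a (pd b f) z = fderiv 𝕜 (fderiv 𝕜 f) z a b := fun a b => by
    have : HasFDerivAt (pd b f) _ z := hd.hasFDerivAt.clm_apply (hasFDerivAt_const b z)
    rw [pd, this.fderiv]
    simp
  rw [key, key, hs.eq]

theorem pd_congr {O : Set E} (hO : IsOpen O) {f g : E → 𝕜} (h : ∀ z ∈ O, f z = g z) (v : E)
    {z : E} (hz : z ∈ O) : pd v f z = pd v g z := by
  have e : f =ᶠ[nhds z] g := by
    filter_upwards [hO.mem_nhds hz] with i hi using h i hi
  rw [pd, pd, e.fderiv_eq]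

/-- Partial derivative in `y` of a function of `(x, y, u)`. -/
def partialY (f : Pt 𝕜 → 𝕜) (z : Pt 𝕜) : 𝕜 := fderiv 𝕜 f z (0, 1, 0)

/-- The space of the variables `(x, y, u, u_1)`. -/
abbrev Pt1 (𝕜 : Type*) := 𝕜 × 𝕜 × 𝕜 × 𝕜

/-- Partial derivatives of a function of `(x, y, u, u_1)`. -/
abbrev qX (f : Pt1 𝕜 → 𝕜) : Pt1 𝕜 → 𝕜 := pd (1, 0, 0, 0) f
abbrev qY (f : Pt1 𝕜 → 𝕜) : Pt1 𝕜 → 𝕜 := pd (0, 1, 0, 0) f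
abbrev qU (f : Pt1 𝕜 → 𝕜) : Pt1 𝕜 → 𝕜 := pd (0, 0, 1, 0) f
abbrev qP (f : Pt1 𝕜 → 𝕜) : Pt1 𝕜 → 𝕜 := pd (0, 0, 0, 1) f

section Pt

variable {U : Set (Pt 𝕜)} {f g : Pt 𝕜 → 𝕜}

/-- `partialX`, `partialY` and `partialU` unfold to `pd` along the basis vectors, so the facts about
`pd` apply definitionally. -/
theorem contDiffOn_partialX (hU : IsOpen U) (hf : ContDiffOn 𝕜 ∞ f U) :
    ContDiffOn 𝕜 ∞ (partialX f) U := ContDiffOn.pd hU hf _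

theorem contDiffOn_partialY (hU : IsOpen U) (hf : ContDiffOn 𝕜 ∞ f U) :
    ContDiffOn 𝕜 ∞ (partialY f) U := ContDiffOn.pd hU hf _

theorem contDiffOn_partialU (hU : IsOpen U) (hf : ContDiffOn 𝕜 ∞ f U) :
    ContDiffOn 𝕜 ∞ (partialU f) U := ContDiffOn.pd hU hf _

theorem partialU_partialX (hU : IsOpen U) (hf : ContDiffOn 𝕜 ∞ f U) {z : Pt 𝕜} (hz : z ∈ U) :
    partialU (partialX f) z = partialX (partialU f) z := pd_comm hU hf _ _ hz

theorem partialY_partialX (hU : IsOpen U) (hf : ContDiffOn 𝕜 ∞ f U) {z : Pt 𝕜} (hz : z ∈ U) :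
    partialY (partialX f) z = partialX (partialY f) z := pd_comm hU hf _ _ hz

theorem partialY_partialU (hU : IsOpen U) (hf : ContDiffOn 𝕜 ∞ f U) {z : Pt 𝕜} (hz : z ∈ U) :
    partialY (partialU f) z = partialU (partialY f) z := pd_comm hU hf _ _ hz

theorem partialX_congr (hU : IsOpen U) (h : ∀ z ∈ U, f z = g z) {z : Pt 𝕜} (hz : z ∈ U) :
    partialX f z = partialX g z := pd_congr hU h _ hz

theorem partialU_congr (hU : IsOpen U) (h : ∀ z ∈ U, f z = g z) {z : Pt 𝕜} (hz : z ∈ U) :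
    partialU f z = partialU g z := pd_congr hU h _ hz

theorem partialU_partialX_partialX (hU : IsOpen U) (hf : ContDiffOn 𝕜 ∞ f U) {z : Pt 𝕜}
    (hz : z ∈ U) : partialU (partialX (partialX f)) z = partialX (partialX (partialU f)) z := by
  rw [partialU_partialX hU (contDiffOn_partialX hU hf) hz]
  exact partialX_congr hU (fun _ h => partialU_partialX hU hf h) hz

theorem partialY_partialX_partialX (hU : IsOpen U) (hf : ContDiffOn 𝕜 ∞ f U) {z : Pt 𝕜}
    (hz : z ∈ U) : partialY (partialX (partialX f)) z = partialX (partialX (partialY f)) z := by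
  rw [partialY_partialX hU (contDiffOn_partialX hU hf) hz]
  exact partialX_congr hU (fun _ h => partialY_partialX hU hf h) hz

theorem fderiv_pt (f : Pt 𝕜 → 𝕜) (z : Pt 𝕜) (a b c : 𝕜) :
    fderiv 𝕜 f z (a, b, c) = a * partialX f z + b * partialY f z + c * partialU f z := by
  have : ((a, b, c) : Pt 𝕜) = a • (1, 0, 0) + b • (0, 1, 0) + c • (0, 0, 1) := by simp
  rw [this]
  simp only [map_add, map_smul, smul_eq_mul, partialX, partialY, partialU]

end Pt

theorem fderiv_pt1 (f : Pt1 𝕜 → 𝕜) (z : Pt1 𝕜) (a b c d : 𝕜) :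
    fderiv 𝕜 f z (a, b, c, d) = a * qX f z + b * qY f z + c * qU f z + d * qP f z := by
  have : ((a, b, c, d) : Pt1 𝕜) =
      a • (1, 0, 0, 0) + b • (0, 1, 0, 0) + c • (0, 0, 1, 0) + d • (0, 0, 0, 1) := by simp
  rw [this]
  simp only [map_add, map_smul, smul_eq_mul, pd]

theorem hasAlongOn_coord (T : Jet 𝕜 → Jet 𝕜) (c : Coord) (O : Set (Jet 𝕜)) :
    HasAlongOn T (fun j => j c) (fun j => T j c) O := fun j _ => by
  have h : HasFDerivAt (fun j : Jet 𝕜 => j c)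
      (ContinuousLinearMap.proj (R := 𝕜) (φ := fun _ : Coord => 𝕜) c) j := hasFDerivAt_apply c j
  exact ⟨h.differentiableAt, by rw [h.fderiv]; rfl⟩

theorem hasFDerivAt_base (j : Jet 𝕜) : HasFDerivAt (base : Jet 𝕜 → Pt 𝕜)
    ((ContinuousLinearMap.proj (R := 𝕜) (φ := fun _ : Coord => 𝕜) .x).prod
      ((ContinuousLinearMap.proj .y).prod (ContinuousLinearMap.proj .u))) j :=
  (hasFDerivAt_apply _ j).prodMk ((hasFDerivAt_apply _ j).prodMk (hasFDerivAt_apply _ j))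

theorem hasFDerivAt_base1 (j : Jet 𝕜) : HasFDerivAt (base1 : Jet 𝕜 → Pt1 𝕜)
    ((ContinuousLinearMap.proj (R := 𝕜) (φ := fun _ : Coord => 𝕜) .x).prod
      ((ContinuousLinearMap.proj .y).prod ((ContinuousLinearMap.proj .u).prod
        (ContinuousLinearMap.proj .u1)))) j :=
  (hasFDerivAt_apply _ j).prodMk ((hasFDerivAt_apply _ j).prodMk
    ((hasFDerivAt_apply _ j).prodMk (hasFDerivAt_apply _ j)))

theorem hasAlongOn_base (T : Jet 𝕜 → Jet 𝕜) {U : Set (Pt 𝕜)} (hU : IsOpen U) {f : Pt 𝕜 → 𝕜}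
    (hf : ContDiffOn 𝕜 ∞ f U) {O : Set (Jet 𝕜)} (hO : ∀ j ∈ O, base j ∈ U) :
    HasAlongOn T (fun j => f (base j)) (fun j => T j .x * partialX f (base j) +
      T j .y * partialY f (base j) + T j .u * partialU f (base j)) O := fun j hj => by
  have h := (differentiableAt_of_contDiffOn hU hf (hO j hj)).hasFDerivAt.comp j (hasFDerivAt_base j)
  refine ⟨h.differentiableAt, ?_⟩
  have e : fderiv 𝕜 (fun j => f (base j)) j = _ := h.fderiv
  rw [e]
  exact fderiv_pt f (base j) _ _ _

/-- The chain rule for an arbitrary vector field on jets: it serves for the total derivatives and,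
with `T = prolong V`, for the invariance conditions. -/
theorem hasAlongOn_base1 (T : Jet 𝕜 → Jet 𝕜) {W : Set (Pt1 𝕜)} (hW : IsOpen W) {f : Pt1 𝕜 → 𝕜}
    (hf : ContDiffOn 𝕜 ∞ f W) {O : Set (Jet 𝕜)} (hO : ∀ j ∈ O, base1 j ∈ W) :
    HasAlongOn T (fun j => f (base1 j)) (fun j => T j .x * qX f (base1 j) +
      T j .y * qY f (base1 j) + T j .u * qU f (base1 j) + T j .u1 * qP f (base1 j)) O :=
    fun j hj => by
  have h := (differentiableAt_of_contDiffOn hW hf (hO j hj)).hasFDerivAt.comp j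
    (hasFDerivAt_base1 j)
  refine ⟨h.differentiableAt, ?_⟩
  have e : fderiv 𝕜 (fun j => f (base1 j)) j = _ := h.fderiv
  rw [e]
  exact fderiv_pt1 f (base1 j) _ _ _ _

/-- The first three total derivatives in `x` of a function of `(x, y, u)`. -/
def totalX (f : Pt 𝕜 → 𝕜) (j : Jet 𝕜) : 𝕜 :=
  partialX f (base j) + j .u1 * partialU f (base j)

def totalXX (f : Pt 𝕜 → 𝕜) (j : Jet 𝕜) : 𝕜 :=
  partialX (partialX f) (base j) + 2 * j .u1 * partialX (partialU f) (base j)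
    + j .u1 ^ 2 * partialU (partialU f) (base j) + j .u11 * partialU f (base j)

def totalXXX (f : Pt 𝕜 → 𝕜) (j : Jet 𝕜) : 𝕜 :=
  partialX (partialX (partialX f)) (base j) + 3 * j .u1 * partialX (partialX (partialU f)) (base j)
    + 3 * j .u1 ^ 2 * partialX (partialU (partialU f)) (base j)
    + j .u1 ^ 3 * partialU (partialU (partialU f)) (base j)
    + 3 * j .u11 * (partialX (partialU f) (base j) + j .u1 * partialU (partialU f) (base j))
    + j .u111 * partialU f (base j)

section Total

variable {U : Set (Pt 𝕜)} {f : Pt 𝕜 → 𝕜} {O : Set (Jet 𝕜)}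

theorem hasAlongOn_totalX (hU : IsOpen U) (hf : ContDiffOn 𝕜 ∞ f U) (hO : ∀ j ∈ O, base j ∈ U) :
    HasAlongOn dirX (fun j => f (base j)) (totalX f) O :=
  (hasAlongOn_base dirX hU hf hO).congr_right fun j _ => by simp only [totalX, dirX]; ring

theorem hasAlongOn_totalXX (hU : IsOpen U) (hf : ContDiffOn 𝕜 ∞ f U) (hO : ∀ j ∈ O, base j ∈ U) :
    HasAlongOn dirX (totalX f) (totalXX f) O :=
  ((hasAlongOn_totalX hU (contDiffOn_partialX hU hf) hO).add
    ((hasAlongOn_coord dirX .u1 O).mul (hasAlongOn_totalX hU (contDiffOn_partialU hU hf) hO))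
    ).congr_right fun j hj => by
      simp only [totalX, totalXX, dirX, partialU_partialX hU hf (hO j hj)]; ring

theorem hasAlongOn_totalXXX (hU : IsOpen U) (hf : ContDiffOn 𝕜 ∞ f U)
    (hO : ∀ j ∈ O, base j ∈ U) : HasAlongOn dirX (totalXX f) (totalXXX f) O := by
  have fX := contDiffOn_partialX hU hf
  have fU := contDiffOn_partialU hU hf
  have p := hasAlongOn_coord dirX (𝕜 := 𝕜) .u1 O
  have h := (((hasAlongOn_totalX hU (contDiffOn_partialX hU fX) hO).add
    (((HasAlongOn.const 2).mul p).mul (hasAlongOn_totalX hU (contDiffOn_partialX hU fU) hO))).add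
    ((p.mul p).mul (hasAlongOn_totalX hU (contDiffOn_partialU hU fU) hO))).add
    ((hasAlongOn_coord dirX .u11 O).mul (hasAlongOn_totalX hU fU hO))
  refine h.congr_of_eq (fun j => by rw [totalXX, pow_two]) fun j hj => ?_
  simp only [totalX, totalXXX, dirX, partialU_partialX hU fU (hO j hj),
    partialU_partialX_partialX hU hf (hO j hj)]
  ring

end Total

end

end LieSymmetry

/-! ### Explicit prolongation coefficients. -/

namespace LieSymmetry

noncomputable section

variable {𝕜 : Type*} [RCLike 𝕜]

section Prolongation

variable {U : Set (Pt 𝕜)} {V : Pt 𝕜 → Pt 𝕜}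

theorem contDiffOn_xi (hV : ContDiffOn 𝕜 ∞ V U) : ContDiffOn 𝕜 ∞ (xi V) U := hV.fst

theorem contDiffOn_tau (hV : ContDiffOn 𝕜 ∞ V U) : ContDiffOn 𝕜 ∞ (tau V) U := hV.snd.fst

theorem contDiffOn_phi (hV : ContDiffOn 𝕜 ∞ V U) : ContDiffOn 𝕜 ∞ (phi V) U := hV.snd.snd

theorem isOpen_preimage_base (hU : IsOpen U) : IsOpen (base ⁻¹' U : Set (Jet 𝕜)) :=
  hU.preimage contDiff_base.continuous

theorem phiX_eq (hU : IsOpen U) (hV : ContDiffOn 𝕜 ∞ V U) {j : Jet 𝕜} (hj : base j ∈ U) :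
    phiX V j = totalX (phi V) j - j .u1 * totalX (xi V) j - j .u2 * totalX (tau V) j := by
  have hO : ∀ i ∈ (base ⁻¹' U : Set (Jet 𝕜)), base i ∈ U := fun _ h => h
  have h0 := (hasAlongOn_totalX hU (contDiffOn_phi hV) hO j hj).2
  have h1 := (hasAlongOn_totalX hU (contDiffOn_xi hV) hO j hj).2
  have h2 := (hasAlongOn_totalX hU (contDiffOn_tau hV) hO j hj).2
  rw [← h0, ← h1, ← h2]
  rfl

theorem phiY_eq (hU : IsOpen U) (hV : ContDiffOn 𝕜 ∞ V U) {j : Jet 𝕜} (hj : base j ∈ U) :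
    phiY V j = partialY (phi V) (base j) + j .u2 * partialU (phi V) (base j)
      - j .u1 * (partialY (xi V) (base j) + j .u2 * partialU (xi V) (base j))
      - j .u2 * (partialY (tau V) (base j) + j .u2 * partialU (tau V) (base j)) := by
  have hO : ∀ i ∈ (base ⁻¹' U : Set (Jet 𝕜)), base i ∈ U := fun _ h => h
  have h0 := (hasAlongOn_base dirY hU (contDiffOn_phi hV) hO j hj).2
  have h1 := (hasAlongOn_base dirY hU (contDiffOn_xi hV) hO j hj).2
  have h2 := (hasAlongOn_base dirY hU (contDiffOn_tau hV) hO j hj).2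
  simp only [dirY, zero_mul, one_mul, zero_add] at h0 h1 h2
  rw [← h0, ← h1, ← h2]
  rfl

theorem hasAlongOn_phiX (hU : IsOpen U) (hV : ContDiffOn 𝕜 ∞ V U) :
    HasAlongOn dirX (phiX V) (fun j => totalXX (phi V) j - j .u1 * totalXX (xi V) j
      - j .u11 * totalX (xi V) j - j .u2 * totalXX (tau V) j - j .u12 * totalX (tau V) j)
      (base ⁻¹' U) := by
  have hO : ∀ i ∈ (base ⁻¹' U : Set (Jet 𝕜)), base i ∈ U := fun _ h => h
  refine (((hasAlongOn_totalXX hU (contDiffOn_phi hV) hO).sub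
    ((hasAlongOn_coord dirX .u1 _).mul (hasAlongOn_totalXX hU (contDiffOn_xi hV) hO))).sub
    ((hasAlongOn_coord dirX .u2 _).mul (hasAlongOn_totalXX hU (contDiffOn_tau hV) hO))).congr
    (isOpen_preimage_base hU) (fun j hj => phiX_eq hU hV hj) fun j _ => ?_
  simp only [dirX]
  ring

theorem phiXX_eq (hU : IsOpen U) (hV : ContDiffOn 𝕜 ∞ V U) {j : Jet 𝕜} (hj : base j ∈ U) :
    phiXX V j = totalXX (phi V) j - j .u1 * totalXX (xi V) j
      - 2 * (j .u11 * totalX (xi V) j) - j .u2 * totalXX (tau V) j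
      - 2 * (j .u12 * totalX (tau V) j) := by
  have hO : ∀ i ∈ (base ⁻¹' U : Set (Jet 𝕜)), base i ∈ U := fun _ h => h
  have h0 := (hasAlongOn_phiX hU hV j hj).2
  have h1 := (hasAlongOn_totalX hU (contDiffOn_xi hV) hO j hj).2
  have h2 := (hasAlongOn_totalX hU (contDiffOn_tau hV) hO j hj).2
  rw [phiXX, prolStep, along, along, along, h0, h1, h2]
  ring

/-- This is the Leibniz expansion of `D_x³ (φ - u_1 ξ - u_2 τ) + u_1111 ξ + u_1112 τ`, whence the
binomial coefficients 3; the fourth-order jets cancel. -/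
theorem phiXXX_eq (hU : IsOpen U) (hV : ContDiffOn 𝕜 ∞ V U) {j : Jet 𝕜} (hj : base j ∈ U) :
    phiXXX V j = totalXXX (phi V) j - j .u1 * totalXXX (xi V) j
      - 3 * (j .u11 * totalXX (xi V) j) - 3 * (j .u111 * totalX (xi V) j)
      - j .u2 * totalXXX (tau V) j
      - 3 * (j .u12 * totalXX (tau V) j) - 3 * (j .u112 * totalX (tau V) j) := by
  have hO : ∀ i ∈ (base ⁻¹' U : Set (Jet 𝕜)), base i ∈ U := fun _ h => h
  have hx := contDiffOn_xi hV
  have ht := contDiffOn_tau hV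
  have c := fun k => hasAlongOn_coord (dirX (𝕜 := 𝕜)) k (base ⁻¹' U)
  have h0 := ((((((hasAlongOn_totalXXX hU (contDiffOn_phi hV) hO).sub
    ((c .u1).mul (hasAlongOn_totalXXX hU hx hO))).sub
    ((HasAlongOn.const 2).mul ((c .u11).mul (hasAlongOn_totalXX hU hx hO)))).sub
    ((c .u2).mul (hasAlongOn_totalXXX hU ht hO))).sub
    ((HasAlongOn.const 2).mul ((c .u12).mul (hasAlongOn_totalXX hU ht hO)))).congr
    (isOpen_preimage_base hU) (fun i hi => phiXX_eq hU hV hi) (fun _ _ => rfl) j hj).2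
  have h1 := (hasAlongOn_totalX hU hx hO j hj).2
  have h2 := (hasAlongOn_totalX hU ht hO j hj).2
  rw [phiXXX, prolStep, along, along, along, h0, h1, h2]
  simp only [dirX]
  ring

end Prolongation

/-! ### Jets that satisfy `u_2 = F` and its total derivatives. -/

/-- The point `(x, y, u)` below `(x, y, u, u_1)`. -/
def proj (q : Pt1 𝕜) : Pt 𝕜 := (q.1, q.2.1, q.2.2.1)

/-- The point `(x, y, u, p)` above `(x, y, u)`. -/
def lift (z : Pt 𝕜) (p : 𝕜) : Pt1 𝕜 := (z.1, z.2.1, z.2.2, p)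

section Solved

/-- The first total derivatives of `F(x, y, u, u_1)`. -/
def totalX1 (F : Pt1 𝕜 → 𝕜) (j : Jet 𝕜) : 𝕜 :=
  qX F (base1 j) + j .u1 * qU F (base1 j) + j .u11 * qP F (base1 j)

def totalY1 (F : Pt1 𝕜 → 𝕜) (j : Jet 𝕜) : 𝕜 :=
  qY F (base1 j) + j .u2 * qU F (base1 j) + j .u12 * qP F (base1 j)

variable {D : Set (Pt1 𝕜)} {F : Pt1 𝕜 → 𝕜}

theorem hasAlongOn_totalX1 (hD : IsOpen D) (hF : ContDiffOn 𝕜 ∞ F D) :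
    HasAlongOn dirX (fun j => F (base1 j)) (totalX1 F) (base1 ⁻¹' D) :=
  (hasAlongOn_base1 dirX hD hF fun _ h => h).congr_right fun j _ => by
    simp only [totalX1, dirX]; ring

theorem hasAlongOn_totalY1 (hD : IsOpen D) (hF : ContDiffOn 𝕜 ∞ F D) :
    HasAlongOn dirY (fun j => F (base1 j)) (totalY1 F) (base1 ⁻¹' D) :=
  (hasAlongOn_base1 dirY hD hF fun _ h => h).congr_right fun j _ => by
    simp only [totalY1, dirY]; ring

/-- The equation `u_2 - F`, as a function on the jet space. -/
def solved (F : Pt1 𝕜 → 𝕜) (j : Jet 𝕜) : 𝕜 := j .u2 - F (base1 j)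

theorem isOpen_preimage_base1 (hD : IsOpen D) : IsOpen (base1 ⁻¹' D : Set (Jet 𝕜)) :=
  hD.preimage (by unfold base1; fun_prop)

theorem hasAlongOn_dirX_solved (hD : IsOpen D) (hF : ContDiffOn 𝕜 ∞ F D) :
    HasAlongOn dirX (solved F) (fun j => j .u12 - totalX1 F j) (base1 ⁻¹' D) :=
  (hasAlongOn_coord dirX .u2 _).sub (hasAlongOn_totalX1 hD hF)

theorem hasAlongOn_dirY_solved (hD : IsOpen D) (hF : ContDiffOn 𝕜 ∞ F D) :
    HasAlongOn dirY (solved F) (fun j => j .u22 - totalY1 F j) (base1 ⁻¹' D) :=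
  (hasAlongOn_coord dirY .u2 _).sub (hasAlongOn_totalY1 hD hF)

/-- The formula for the first total derivative holds on an open set of jets, not only on solutions,
so it can be differentiated once more. -/
theorem along_dirX_dirX_solved (hD : IsOpen D) (hF : ContDiffOn 𝕜 ∞ F D) {j : Jet 𝕜}
    (hj : base1 j ∈ D) : along dirX (along dirX (solved F)) j =
      j .u112 - (totalX1 (qX F) j + (j .u11 * qU F (base1 j) + j .u1 * totalX1 (qU F) j)
        + (j .u111 * qP F (base1 j) + j .u11 * totalX1 (qP F) j)) :=
  (((hasAlongOn_coord dirX .u12 _).sub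
    (((hasAlongOn_totalX1 hD (ContDiffOn.pd hD hF _)).add
      ((hasAlongOn_coord dirX .u1 _).mul (hasAlongOn_totalX1 hD (ContDiffOn.pd hD hF _)))).add
      ((hasAlongOn_coord dirX .u11 _).mul (hasAlongOn_totalX1 hD (ContDiffOn.pd hD hF _))))).congr
    (isOpen_preimage_base1 hD) (fun i hi => (hasAlongOn_dirX_solved hD hF i hi).2)
    (fun _ _ => rfl) j hj).2

theorem along_dirX_dirY_solved (hD : IsOpen D) (hF : ContDiffOn 𝕜 ∞ F D) {j : Jet 𝕜}
    (hj : base1 j ∈ D) : along dirX (along dirY (solved F)) j =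
      j .u122 - (totalX1 (qY F) j + (j .u12 * qU F (base1 j) + j .u2 * totalX1 (qU F) j)
        + (j .u112 * qP F (base1 j) + j .u12 * totalX1 (qP F) j)) :=
  (((hasAlongOn_coord dirX .u22 _).sub
    (((hasAlongOn_totalX1 hD (ContDiffOn.pd hD hF _)).add
      ((hasAlongOn_coord dirX .u2 _).mul (hasAlongOn_totalX1 hD (ContDiffOn.pd hD hF _)))).add
      ((hasAlongOn_coord dirX .u12 _).mul (hasAlongOn_totalX1 hD (ContDiffOn.pd hD hF _))))).congr
    (isOpen_preimage_base1 hD) (fun i hi => (hasAlongOn_dirY_solved hD hF i hi).2)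
    (fun _ _ => rfl) j hj).2

theorem along_dirY_dirY_solved (hD : IsOpen D) (hF : ContDiffOn 𝕜 ∞ F D) {j : Jet 𝕜}
    (hj : base1 j ∈ D) : along dirY (along dirY (solved F)) j =
      j .u222 - (totalY1 (qY F) j + (j .u22 * qU F (base1 j) + j .u2 * totalY1 (qU F) j)
        + (j .u122 * qP F (base1 j) + j .u12 * totalY1 (qP F) j)) :=
  (((hasAlongOn_coord dirY .u22 _).sub
    (((hasAlongOn_totalY1 hD (ContDiffOn.pd hD hF _)).add
      ((hasAlongOn_coord dirY .u2 _).mul (hasAlongOn_totalY1 hD (ContDiffOn.pd hD hF _)))).add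
      ((hasAlongOn_coord dirY .u12 _).mul (hasAlongOn_totalY1 hD (ContDiffOn.pd hD hF _))))).congr
    (isOpen_preimage_base1 hD) (fun i hi => (hasAlongOn_dirY_solved hD hF i hi).2)
    (fun _ _ => rfl) j hj).2

/-- Over every `(x, y, u, u_1, u_11)` there is a jet that satisfies `u_2 = F` together with its
total derivatives and has a prescribed `u_111`. -/
theorem exists_jet (hD : IsOpen D) (hF : ContDiffOn 𝕜 ∞ F D) {q : Pt1 𝕜} (hq : q ∈ D) (r g : 𝕜) :
    ∃ j : Jet 𝕜, base1 j = q ∧ j .u11 = r ∧ j .u111 = g ∧ solved F j = 0 ∧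
      along dirX (solved F) j = 0 ∧ along dirY (solved F) j = 0 ∧
      along dirX (along dirX (solved F)) j = 0 ∧ along dirX (along dirY (solved F)) j = 0 ∧
      along dirY (along dirY (solved F)) j = 0 := by
  obtain ⟨x, y, u, p⟩ := q
  set q : Pt1 𝕜 := (x, y, u, p) with hq_def
  -- Each of the six equations is linear with coefficient 1 in one new coordinate. Solving them in
  -- the order `u_2, u_12, u_22, u_112, u_122, u_222` uses only coordinates already fixed.
  set u2 := F q with h2
  set dX : (Pt1 𝕜 → 𝕜) → 𝕜 := fun k => qX k q + p * qU k q + r * qP k q with hdX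
  set u12 := dX F with h12
  set dY : (Pt1 𝕜 → 𝕜) → 𝕜 := fun k => qY k q + u2 * qU k q + u12 * qP k q with hdY
  set u22 := dY F with h22
  set u112 := dX (qX F) + (r * qU F q + p * dX (qU F)) + (g * qP F q + r * dX (qP F)) with h112
  set u122 := dX (qY F) + (u12 * qU F q + u2 * dX (qU F)) + (u112 * qP F q + u12 * dX (qP F))
    with h122
  set u222 := dY (qY F) + (u22 * qU F q + u2 * dY (qU F)) + (u122 * qP F q + u12 * dY (qP F))
    with h222
  let j : Jet 𝕜 := fun c => match c with
    | .x => x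
    | .y => y
    | .u => u
    | .u1 => p
    | .u2 => u2
    | .u11 => r
    | .u12 => u12
    | .u22 => u22
    | .u111 => g
    | .u112 => u112
    | .u122 => u122
    | .u222 => u222
  have hjD : base1 j ∈ D := hq
  refine ⟨j, rfl, rfl, rfl, sub_self _, ?_, ?_, ?_, ?_, ?_⟩
  · exact (hasAlongOn_dirX_solved hD hF j hjD).2.trans (sub_self _)
  · exact (hasAlongOn_dirY_solved hD hF j hjD).2.trans (sub_self _)
  · exact (along_dirX_dirX_solved hD hF hjD).trans (sub_self _)
  · exact (along_dirX_dirY_solved hD hF hjD).trans (sub_self _)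
  · exact (along_dirY_dirY_solved hD hF hjD).trans (sub_self _)

end Solved

end

end LieSymmetry

/-! ### The determining equations. -/

namespace LieSymmetry

noncomputable section

variable {𝕜 : Type*} [RCLike 𝕜]

namespace System

/-- The part of `W` above `U`. -/
def dom (S : System 𝕜) : Set (Pt1 𝕜) := {q | proj q ∈ S.U ∧ q ∈ S.W}

/-- The right-hand side `F1 u_1 + F2 u_1² + F3 u_1³` of the first equation. -/
def rhs (S : System 𝕜) (q : Pt1 𝕜) : 𝕜 :=
  S.F1 (proj q) * q.2.2.2 + S.F2 (proj q) * q.2.2.2 ^ 2 + S.F3 q * q.2.2.2 ^ 3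

variable {S : System 𝕜} {V : Pt 𝕜 → Pt 𝕜}

theorem isOpen_dom (hU : IsOpen S.U) (hW : IsOpen S.W) : IsOpen S.dom :=
  (hU.preimage (by unfold proj; fun_prop)).inter hW

/-- The first determining equation, before separation with respect to `p = u_1`. -/
theorem IsSymmetry.determining_first (hV : S.IsSymmetry V) (hU : IsOpen S.U) (hW : IsOpen S.W)
    (hF : ContDiffOn 𝕜 ∞ S.rhs S.dom)
    {z : Pt 𝕜} {p : 𝕜} (hq : lift z p ∈ S.dom) :
    partialY (phi V) z + S.rhs (lift z p) * partialU (phi V) z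
      - p * (partialY (xi V) z + S.rhs (lift z p) * partialU (xi V) z)
      - S.rhs (lift z p) * (partialY (tau V) z + S.rhs (lift z p) * partialU (tau V) z)
      - (xi V z * qX S.rhs (lift z p) + tau V z * qY S.rhs (lift z p)
        + phi V z * qU S.rhs (lift z p)
        + (partialX (phi V) z + p * partialU (phi V) z
          - p * (partialX (xi V) z + p * partialU (xi V) z)
          - S.rhs (lift z p) * (partialX (tau V) z + p * partialU (tau V) z))
          * qP S.rhs (lift z p)) = 0 := by
  have hD := isOpen_dom hU hW
  -- The first condition involves only first-order jets, so any value of `u_11` will do; `u_111 = G`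
  -- places the jet on the second equation.
  obtain ⟨j, hj, hr, hg, h1, h2, h3, h4, h5, h6⟩ := exists_jet hD hF hq 0 (S.G (lift z p))
  have hjD : base1 j ∈ S.dom := hj ▸ hq
  have hb : base j = z := congrArg proj hj
  have hp : j .u1 = p := congrArg (fun q : Pt1 𝕜 => q.2.2.2) hj
  have hu2 : j .u2 = S.rhs (lift z p) := by rw [← hj]; exact sub_eq_zero.1 h1
  -- `S.eq1` is definitionally `solved S.rhs`, so the properties of `j` are those required by
  -- `variety`.
  have hjV : j ∈ S.variety := ⟨hjD.1, hjD.2, h1, h2, h3, h4, h5, h6, by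
    rw [eq2, hg, hj, sub_self]⟩
  have h := (hV.2 j hjV).1
  have hd := (((hasAlongOn_coord (prolong V) .u2 _).sub
    (hasAlongOn_base1 (prolong V) hD hF fun _ h => h)) j hjD).2
  have e := hd.symm.trans h
  simp only [prolong, phiX_eq hU hV.1 hjD.1, phiY_eq hU hV.1 hjD.1, totalX, phi0,
    hb, hj, hp, hu2] at e
  linear_combination e

/-- The second determining equation, separated with respect to `u_11`, but not with respect to
`p = u_1`. -/
theorem IsSymmetry.determining_second (hV : S.IsSymmetry V) (hU : IsOpen S.U) (hW : IsOpen S.W)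
    (hF : ContDiffOn 𝕜 ∞ S.rhs S.dom) (hG : ContDiffOn 𝕜 ∞ S.G S.dom)
    {z : Pt 𝕜} {p : 𝕜} (hq : lift z p ∈ S.dom) :
    (partialU (xi V) z + qP S.rhs (lift z p) * partialU (tau V) z
      + qP (qP S.rhs) (lift z p) * (partialX (tau V) z + p * partialU (tau V) z) = 0) ∧
    (partialX (partialU (phi V)) z + p * partialU (partialU (phi V)) z
      - p * (partialX (partialU (xi V)) z + p * partialU (partialU (xi V)) z)
      - (partialX (partialX (xi V)) z + 2 * p * partialX (partialU (xi V)) z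
        + p * p * partialU (partialU (xi V)) z)
      - S.rhs (lift z p) * (partialX (partialU (tau V)) z + p * partialU (partialU (tau V)) z)
      - qP S.rhs (lift z p) * (partialX (partialX (tau V)) z
        + 2 * p * partialX (partialU (tau V)) z + p * p * partialU (partialU (tau V)) z)
      - (qX S.rhs (lift z p) + p * qU S.rhs (lift z p)) * partialU (tau V) z
      - (2 * qX (qP S.rhs) (lift z p) + qU S.rhs (lift z p) + 2 * p * qU (qP S.rhs) (lift z p))
        * (partialX (tau V) z + p * partialU (tau V) z) = 0) ∧
    (partialX (partialX (partialX (phi V))) z + 3 * p * partialX (partialX (partialU (phi V))) z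
      + 3 * p * p * partialX (partialU (partialU (phi V))) z
      + p * p * p * partialU (partialU (partialU (phi V))) z
      + S.G (lift z p) * partialU (phi V) z
      - p * (partialX (partialX (partialX (xi V))) z
        + 3 * p * partialX (partialX (partialU (xi V))) z
        + 3 * p * p * partialX (partialU (partialU (xi V))) z
        + p * p * p * partialU (partialU (partialU (xi V))) z
        + S.G (lift z p) * partialU (xi V) z)
      - 3 * S.G (lift z p) * (partialX (xi V) z + p * partialU (xi V) z)
      - S.rhs (lift z p) * (partialX (partialX (partialX (tau V))) z
        + 3 * p * partialX (partialX (partialU (tau V))) z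
        + 3 * p * p * partialX (partialU (partialU (tau V))) z
        + p * p * p * partialU (partialU (partialU (tau V))) z
        + S.G (lift z p) * partialU (tau V) z)
      - 3 * (qX S.rhs (lift z p) + p * qU S.rhs (lift z p)) * (partialX (partialX (tau V)) z
        + 2 * p * partialX (partialU (tau V)) z + p * p * partialU (partialU (tau V)) z)
      - 3 * (S.G (lift z p) * qP S.rhs (lift z p) + qX (qX S.rhs) (lift z p)
        + 2 * p * qU (qX S.rhs) (lift z p) + p * p * qU (qU S.rhs) (lift z p))
        * (partialX (tau V) z + p * partialU (tau V) z)
      - (xi V z * qX S.G (lift z p) + tau V z * qY S.G (lift z p) + phi V z * qU S.G (lift z p)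
        + (partialX (phi V) z + p * partialU (phi V) z
          - p * (partialX (xi V) z + p * partialU (xi V) z)
          - S.rhs (lift z p) * (partialX (tau V) z + p * partialU (tau V) z))
          * qP S.G (lift z p)) = 0) := by
  have hD := isOpen_dom hU hW
  -- On the system the second condition is a quadratic polynomial in `r = u_11`; its values at `0,
  -- 1, -1` determine the three coefficients. The factors `3` and `-3` come from the prolongation
  -- formula.
  have quad : ∀ a b c : 𝕜, (∀ r, c + 3 * b * r - 3 * a * r ^ 2 = 0) → a = 0 ∧ b = 0 ∧ c = 0 := by
    intro a b c h
    have h0 := h 0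
    have h1 := h 1
    have h2 := h (-1)
    exact ⟨by linear_combination (2 * h0 - h1 - h2) / 6, by linear_combination (h1 - h2) / 6,
      by linear_combination h0⟩
  refine quad _ _ _ fun r => ?_
  obtain ⟨j, hj, hr, hg, h1, h2, h3, h4, h5, h6⟩ := exists_jet hD hF hq r (S.G (lift z p))
  have hjD : base1 j ∈ S.dom := hj ▸ hq
  have hb : base j = z := congrArg proj hj
  have hp : j .u1 = p := congrArg (fun q : Pt1 𝕜 => q.2.2.2) hj
  have hu2 : j .u2 = S.rhs (lift z p) := by rw [← hj]; exact sub_eq_zero.1 h1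
  have hu12 := sub_eq_zero.1 ((hasAlongOn_dirX_solved hD hF j hjD).2.symm.trans h2)
  have hu112 := sub_eq_zero.1 ((along_dirX_dirX_solved hD hF hjD).symm.trans h4)
  simp only [totalX1, hj, hp, hr, hg] at hu12 hu112
  have hjV : j ∈ S.variety := ⟨hjD.1, hjD.2, h1, h2, h3, h4, h5, h6, by
    rw [eq2, hg, hj, sub_self]⟩
  have h := (hV.2 j hjV).2
  have hd := (((hasAlongOn_coord (prolong V) .u111 _).sub
    (hasAlongOn_base1 (prolong V) hD hG fun _ h => h)) j hjD).2
  have e := hd.symm.trans h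
  simp only [prolong, phiX_eq hU hV.1 hjD.1, phiXXX_eq hU hV.1 hjD.1, totalX, totalXX, totalXXX,
    phi0, hb, hj, hp, hu2, hr, hg, hu12, hu112] at e
  -- Mixed partials are put in the same order in the goal and in `e`.
  rw [show qX (qP S.rhs) (lift z p) = qP (qX S.rhs) (lift z p) from pd_comm hD hF _ _ hq,
    show qU (qP S.rhs) (lift z p) = qP (qU S.rhs) (lift z p) from pd_comm hD hF _ _ hq,
    show qU (qX S.rhs) (lift z p) = qX (qU S.rhs) (lift z p) from pd_comm hD hF _ _ hq]
  rw [show qX (qP S.rhs) (lift z p) = qP (qX S.rhs) (lift z p) from pd_comm hD hF _ _ hq,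
    show qU (qP S.rhs) (lift z p) = qP (qU S.rhs) (lift z p) from pd_comm hD hF _ _ hq,
    show qU (qX S.rhs) (lift z p) = qX (qU S.rhs) (lift z p) from pd_comm hD hF _ _ hq] at e
  linear_combination e

end System

/-! ### Taylor coefficients in `u_1` at `u_1 = 0`. -/

/-- `f` is twice differentiable at `0`, and `f(0) = a`, `f'(0) = b`, `f''(0) = c`. -/
def HasTaylor (f : 𝕜 → 𝕜) (a b c : 𝕜) : Prop :=
  ∃ f' : 𝕜 → 𝕜, (∀ᶠ p in nhds 0, HasDerivAt f (f' p) p) ∧ HasDerivAt f' c 0 ∧ f 0 = a ∧ f' 0 = b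

namespace HasTaylor

variable {f g : 𝕜 → 𝕜} {a b c a' b' c' : 𝕜}

theorem add (hf : HasTaylor f a b c) (hg : HasTaylor g a' b' c') :
    HasTaylor (fun p => f p + g p) (a + a') (b + b') (c + c') := by
  obtain ⟨f', f1, f2, rfl, rfl⟩ := hf
  obtain ⟨g', g1, g2, rfl, rfl⟩ := hg
  exact ⟨fun p => f' p + g' p, by filter_upwards [f1, g1] with p h1 h2 using h1.add h2,
    f2.add g2, rfl, rfl⟩

theorem sub (hf : HasTaylor f a b c) (hg : HasTaylor g a' b' c') :
    HasTaylor (fun p => f p - g p) (a - a') (b - b') (c - c') := by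
  obtain ⟨f', f1, f2, rfl, rfl⟩ := hf
  obtain ⟨g', g1, g2, rfl, rfl⟩ := hg
  exact ⟨fun p => f' p - g' p, by filter_upwards [f1, g1] with p h1 h2 using h1.sub h2,
    f2.sub g2, rfl, rfl⟩

theorem mul (hf : HasTaylor f a b c) (hg : HasTaylor g a' b' c') :
    HasTaylor (fun p => f p * g p) (a * a') (b * a' + a * b')
      (c * a' + 2 * (b * b') + a * c') := by
  obtain ⟨f', f1, f2, rfl, rfl⟩ := hf
  obtain ⟨g', g1, g2, rfl, rfl⟩ := hg
  refine ⟨fun p => f' p * g p + f p * g' p,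
    by filter_upwards [f1, g1] with p h1 h2 using h1.mul h2, ?_, rfl, rfl⟩
  exact ((f2.mul g1.self_of_nhds).add (f1.self_of_nhds.mul g2)).congr_deriv (by ring)

theorem const (a : 𝕜) : HasTaylor (fun _ => a) a 0 0 :=
  ⟨fun _ => 0, .of_forall fun p => hasDerivAt_const p a, hasDerivAt_const 0 0, rfl, rfl⟩

theorem id : HasTaylor (fun p : 𝕜 => p) 0 1 0 :=
  ⟨fun _ => 1, .of_forall fun p => hasDerivAt_id p, hasDerivAt_const 0 1, rfl, rfl⟩

/-- A function that vanishes near `0` has a derivative that vanishes near `0`. This separates an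
identity in `p` that is known only for small `p`, which is all that an open `W` provides. -/
theorem eq_zero (hf : HasTaylor f a b c) (h : ∀ᶠ p in nhds 0, f p = 0) :
    a = 0 ∧ b = 0 ∧ c = 0 := by
  obtain ⟨f', f1, f2, rfl, rfl⟩ := hf
  have h' : ∀ᶠ p in nhds 0, f' p = 0 := by
    filter_upwards [f1, h.eventually_nhds] with p h1 h2
    exact h1.unique ((hasDerivAt_const p 0).congr_of_eventuallyEq h2)
  exact ⟨h.self_of_nhds, h'.self_of_nhds,
    f2.unique ((hasDerivAt_const 0 0).congr_of_eventuallyEq h')⟩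

end HasTaylor

section Slice

/-- Restriction of a function of `(x, y, u, u_1)` to `u_1 = 0`. -/
def slice (k : Pt1 𝕜 → 𝕜) (z : Pt 𝕜) : 𝕜 := k (lift z 0)

variable {D : Set (Pt1 𝕜)} {U : Set (Pt 𝕜)} {k : Pt1 𝕜 → 𝕜}

theorem contDiffOn_slice (hUD : ∀ z ∈ U, lift z 0 ∈ D) (hk : ContDiffOn 𝕜 ∞ k D) :
    ContDiffOn 𝕜 ∞ (slice k) U :=
  hk.comp (g := k) (f := fun z => lift z 0) (by unfold lift; fun_prop) hUD

/-- The embedding `z ↦ lift z 0` has derivative `(a, b, c) ↦ (a, b, c, 0)`; hence restriction to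
`u_1 = 0` commutes with derivatives in `x, y, u`. -/
theorem fderiv_slice (hD : IsOpen D) (hk : ContDiffOn 𝕜 ∞ k D) {z : Pt 𝕜}
    (hz : lift z 0 ∈ D) (a b c : 𝕜) :
    fderiv 𝕜 (slice k) z (a, b, c) = fderiv 𝕜 k (lift z 0) (a, b, c, 0) := by
  have hl : HasFDerivAt (fun z : Pt 𝕜 => lift z 0)
      ((ContinuousLinearMap.fst 𝕜 𝕜 (𝕜 × 𝕜)).prod
        (((ContinuousLinearMap.fst 𝕜 𝕜 𝕜).comp (ContinuousLinearMap.snd 𝕜 𝕜 (𝕜 × 𝕜))).prod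
          (((ContinuousLinearMap.snd 𝕜 𝕜 𝕜).comp (ContinuousLinearMap.snd 𝕜 𝕜 (𝕜 × 𝕜))).prod
            0))) z :=
    hasFDerivAt_fst.prodMk (hasFDerivAt_snd.fst.prodMk
      (hasFDerivAt_snd.snd.prodMk (hasFDerivAt_const 0 z)))
  have h := (differentiableAt_of_contDiffOn hD hk hz).hasFDerivAt.comp z hl
  have e : fderiv 𝕜 (slice k) z = _ := h.fderiv
  rw [e]
  rfl

theorem slice_qX (hD : IsOpen D) (hk : ContDiffOn 𝕜 ∞ k D) {z : Pt 𝕜} (hz : lift z 0 ∈ D) :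
    slice (qX k) z = partialX (slice k) z := (fderiv_slice hD hk hz 1 0 0).symm

theorem slice_qY (hD : IsOpen D) (hk : ContDiffOn 𝕜 ∞ k D) {z : Pt 𝕜} (hz : lift z 0 ∈ D) :
    slice (qY k) z = partialY (slice k) z := (fderiv_slice hD hk hz 0 1 0).symm

theorem slice_qU (hD : IsOpen D) (hk : ContDiffOn 𝕜 ∞ k D) {z : Pt 𝕜} (hz : lift z 0 ∈ D) :
    slice (qU k) z = partialU (slice k) z := (fderiv_slice hD hk hz 0 0 1).symm

theorem hasDerivAt_lift (hD : IsOpen D) (hk : ContDiffOn 𝕜 ∞ k D) {z : Pt 𝕜} {p : 𝕜}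
    (hz : lift z p ∈ D) : HasDerivAt (fun p => k (lift z p)) (qP k (lift z p)) p := by
  have hl : HasDerivAt (fun p => lift z p) ((0, 0, 0, 1) : Pt1 𝕜) p :=
    (hasDerivAt_const p _).prodMk ((hasDerivAt_const p _).prodMk
      ((hasDerivAt_const p _).prodMk (hasDerivAt_id p)))
  exact (differentiableAt_of_contDiffOn hD hk hz).hasFDerivAt.comp_hasDerivAt p hl

theorem eventually_lift_mem (hD : IsOpen D) {z : Pt 𝕜} (hz : lift z 0 ∈ D) :
    ∀ᶠ p in nhds 0, lift z p ∈ D :=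
  (hD.preimage (by unfold lift; fun_prop : Continuous fun p => lift z p)).mem_nhds hz

theorem hasTaylor_lift (hD : IsOpen D) (hk : ContDiffOn 𝕜 ∞ k D) {z : Pt 𝕜}
    (hz : lift z 0 ∈ D) : HasTaylor (fun p => k (lift z p)) (slice k z) (slice (qP k) z)
      (slice (qP (qP k)) z) :=
  ⟨fun p => qP k (lift z p),
    by filter_upwards [eventually_lift_mem hD hz] with p hp using hasDerivAt_lift hD hk hp,
    hasDerivAt_lift hD (ContDiffOn.pd hD hk _) hz, rfl, rfl⟩

end Slice

end

end LieSymmetry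

namespace LieSymmetry

noncomputable section

variable {𝕜 : Type*} [RCLike 𝕜]

section Slice

variable {D : Set (Pt1 𝕜)} {k : Pt1 𝕜 → 𝕜}

theorem qP_qP_pd (hD : IsOpen D) (hk : ContDiffOn 𝕜 ∞ k D) (v : Pt1 𝕜) {q : Pt1 𝕜} (hq : q ∈ D) :
    qP (qP (pd v k)) q = pd v (qP (qP k)) q := by
  rw [qP, pd_congr hD (fun _ h => pd_comm hD hk (0, 0, 0, 1) v h) _ hq]
  exact pd_comm hD (ContDiffOn.pd hD hk _) _ _ hq

/-- Mixed partials commute, so the derivatives in `p` can be taken first: the Taylor coefficients of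
a derivative of `k` become derivatives of those of `k`. -/
theorem hasTaylor_pd (hD : IsOpen D) (hk : ContDiffOn 𝕜 ∞ k D) (v : Pt1 𝕜) {z : Pt 𝕜}
    (hz : lift z 0 ∈ D) : HasTaylor (fun p => pd v k (lift z p)) (slice (pd v k) z)
      (slice (pd v (qP k)) z) (slice (pd v (qP (qP k))) z) := by
  have h := hasTaylor_lift hD (ContDiffOn.pd hD hk v) hz
  have e1 : slice (qP (pd v k)) z = slice (pd v (qP k)) z := pd_comm hD hk _ _ hz
  have e2 : slice (qP (qP (pd v k))) z = slice (pd v (qP (qP k))) z := qP_qP_pd hD hk v hz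
  rwa [e1, e2] at h

theorem hasTaylor_qX (hD : IsOpen D) (hk : ContDiffOn 𝕜 ∞ k D) {z : Pt 𝕜}
    (hz : lift z 0 ∈ D) : HasTaylor (fun p => qX k (lift z p)) (partialX (slice k) z)
      (partialX (slice (qP k)) z) (partialX (slice (qP (qP k))) z) := by
  have hP := ContDiffOn.pd hD hk (0, 0, 0, 1)
  rw [← slice_qX hD hk hz, ← slice_qX hD hP hz, ← slice_qX hD (ContDiffOn.pd hD hP _) hz]
  exact hasTaylor_pd hD hk _ hz

theorem hasTaylor_qY (hD : IsOpen D) (hk : ContDiffOn 𝕜 ∞ k D) {z : Pt 𝕜}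
    (hz : lift z 0 ∈ D) : HasTaylor (fun p => qY k (lift z p)) (partialY (slice k) z)
      (partialY (slice (qP k)) z) (partialY (slice (qP (qP k))) z) := by
  have hP := ContDiffOn.pd hD hk (0, 0, 0, 1)
  rw [← slice_qY hD hk hz, ← slice_qY hD hP hz, ← slice_qY hD (ContDiffOn.pd hD hP _) hz]
  exact hasTaylor_pd hD hk _ hz

theorem hasTaylor_qU (hD : IsOpen D) (hk : ContDiffOn 𝕜 ∞ k D) {z : Pt 𝕜}
    (hz : lift z 0 ∈ D) : HasTaylor (fun p => qU k (lift z p)) (partialU (slice k) z)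
      (partialU (slice (qP k)) z) (partialU (slice (qP (qP k))) z) := by
  have hP := ContDiffOn.pd hD hk (0, 0, 0, 1)
  rw [← slice_qU hD hk hz, ← slice_qU hD hP hz, ← slice_qU hD (ContDiffOn.pd hD hP _) hz]
  exact hasTaylor_pd hD hk _ hz

end Slice

theorem pd_eq_zero_of_eq_zero {E : Type*} [NormedAddCommGroup E] [NormedSpace 𝕜 E] {O : Set E}
    (hO : IsOpen O) {f : E → 𝕜} (h : ∀ z ∈ O, f z = 0) (v : E) {z : E} (hz : z ∈ O) :
    pd v f z = 0 := by
  rw [pd_congr hO (g := fun _ => 0) h v hz]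
  simp [pd]

/-! ### Separation of the determining equations in `u_1`. -/

namespace System

variable {S : System 𝕜} {V : Pt 𝕜 → Pt 𝕜}

/-- The analyticity hypotheses on a system, reduced to smoothness. -/
structure IsSmooth (S : System 𝕜) : Prop where
  isOpen_U : IsOpen S.U
  isOpen_W : IsOpen S.W
  lift_mem : ∀ z ∈ S.U, lift z 0 ∈ S.W
  contDiffOn_F1 : ContDiffOn 𝕜 ∞ S.F1 S.U
  contDiffOn_F2 : ContDiffOn 𝕜 ∞ S.F2 S.U
  contDiffOn_F3 : ContDiffOn 𝕜 ∞ S.F3 S.W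
  contDiffOn_G : ContDiffOn 𝕜 ∞ S.G S.W

theorem IsSmooth.isOpen_dom (hS : S.IsSmooth) : IsOpen S.dom :=
  System.isOpen_dom hS.isOpen_U hS.isOpen_W

theorem IsSmooth.lift_mem_dom (hS : S.IsSmooth) {z : Pt 𝕜} (hz : z ∈ S.U) : lift z 0 ∈ S.dom :=
  ⟨hz, hS.lift_mem z hz⟩

theorem IsSmooth.contDiffOn_G_dom (hS : S.IsSmooth) : ContDiffOn 𝕜 ∞ S.G S.dom :=
  hS.contDiffOn_G.mono fun _ h => h.2

theorem IsSmooth.contDiffOn_rhs (hS : S.IsSmooth) : ContDiffOn 𝕜 ∞ S.rhs S.dom := by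
  have hp : ContDiffOn 𝕜 ∞ (proj : Pt1 𝕜 → Pt 𝕜) S.dom := by unfold proj; fun_prop
  have h4 : ContDiffOn 𝕜 ∞ (fun q : Pt1 𝕜 => q.2.2.2) S.dom := by fun_prop
  have h1 := hS.contDiffOn_F1.comp hp fun _ h => h.1
  have h2 := hS.contDiffOn_F2.comp hp fun _ h => h.1
  have h3 := hS.contDiffOn_F3.mono fun _ (h : _ ∈ S.dom) => h.2
  exact ((h1.mul h4).add (h2.mul (h4.pow 2))).add (h3.mul (h4.pow 3))

/-- The Taylor coefficients (times factorials) of the right-hand sides in `u_1` at `u_1 = 0`. -/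
def f1 (S : System 𝕜) : Pt 𝕜 → 𝕜 := slice (qP S.rhs)
def f2 (S : System 𝕜) : Pt 𝕜 → 𝕜 := slice (qP (qP S.rhs))
def f3 (S : System 𝕜) : Pt 𝕜 → 𝕜 := slice (qP (qP (qP S.rhs)))
def g0 (S : System 𝕜) : Pt 𝕜 → 𝕜 := slice S.G
def g1 (S : System 𝕜) : Pt 𝕜 → 𝕜 := slice (qP S.G)
def g2 (S : System 𝕜) : Pt 𝕜 → 𝕜 := slice (qP (qP S.G))

theorem slice_rhs (S : System 𝕜) (z : Pt 𝕜) : slice S.rhs z = 0 := by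
  simp [slice, rhs, lift]

/-- The term `F3 u_1³` does not contribute at order two. This turns the hypothesis on `F2` into
invertibility of `f2`. -/
theorem IsSmooth.f2_eq (hS : S.IsSmooth) {z : Pt 𝕜} (hz : z ∈ S.U) : S.f2 z = 2 * S.F2 z := by
  have hD := hS.isOpen_dom
  have h := hasTaylor_lift hD hS.contDiffOn_rhs (hS.lift_mem_dom hz)
  have h3 := hasTaylor_lift hD (hS.contDiffOn_F3.mono fun _ (h : _ ∈ S.dom) => h.2)
    (hS.lift_mem_dom hz)
  have P := HasTaylor.id (𝕜 := 𝕜)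
  have h' := (((HasTaylor.const (S.F1 z)).mul P).add
    ((HasTaylor.const (S.F2 z)).mul (P.mul P))).add (h3.mul (P.mul (P.mul P)))
  have e := ((h.sub h').eq_zero (.of_forall fun p => by simp only [rhs, lift, proj]; ring)).2.2
  rw [f2]
  linear_combination e

/-- The three parts are the Taylor coefficients of orders 0, 1, 2 in `p` of `determining_first`. -/
theorem IsSymmetry.separated_first (hV : S.IsSymmetry V) (hS : S.IsSmooth) {z : Pt 𝕜}
    (hz : z ∈ S.U) :
    partialY (phi V) z = S.f1 z * partialX (phi V) z ∧
    partialY (xi V) z = -S.f1 z * partialY (tau V) z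
      - (xi V z * partialX S.f1 z + tau V z * partialY S.f1 z + phi V z * partialU S.f1 z)
      + (partialX (xi V) z + S.f1 z * partialX (tau V) z) * S.f1 z
      - partialX (phi V) z * S.f2 z ∧
    S.f2 z * partialY (tau V) z = -S.f2 z * partialU (phi V) z
      - (xi V z * partialX S.f2 z + tau V z * partialY S.f2 z + phi V z * partialU S.f2 z)
      + 3 * S.f1 z * S.f2 z * partialX (tau V) z + 2 * S.f2 z * partialX (xi V) z
      - partialX (phi V) z * S.f3 z := by
  have hD := hS.isOpen_dom
  have hF := hS.contDiffOn_rhs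
  have h0 := hS.lift_mem_dom hz
  have c := HasTaylor.const (𝕜 := 𝕜)
  have P := HasTaylor.id (𝕜 := 𝕜)
  have F := hasTaylor_lift hD hF h0
  have FX := hasTaylor_qX hD hF h0
  have FY := hasTaylor_qY hD hF h0
  have FU := hasTaylor_qU hD hF h0
  have FP := hasTaylor_lift hD (ContDiffOn.pd hD hF (0, 0, 0, 1)) h0
  -- `F` is divisible by `u_1`, so its derivatives in `x, y, u` vanish at `u_1 = 0`.
  have zX : partialX (slice S.rhs) z = 0 :=
    pd_eq_zero_of_eq_zero hS.isOpen_U (fun z _ => S.slice_rhs z) _ hz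
  have zY : partialY (slice S.rhs) z = 0 :=
    pd_eq_zero_of_eq_zero hS.isOpen_U (fun z _ => S.slice_rhs z) _ hz
  have zU : partialU (slice S.rhs) z = 0 :=
    pd_eq_zero_of_eq_zero hS.isOpen_U (fun z _ => S.slice_rhs z) _ hz
  rw [slice_rhs] at F
  rw [zX] at FX
  rw [zY] at FY
  rw [zU] at FU
  obtain ⟨e0, e1, e2⟩ := ((((((c (partialY (phi V) z)).add (F.mul (c (partialU (phi V) z)))).sub
    (P.mul ((c (partialY (xi V) z)).add (F.mul (c (partialU (xi V) z)))))).sub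
    (F.mul ((c (partialY (tau V) z)).add (F.mul (c (partialU (tau V) z)))))).sub
    (((((c (xi V z)).mul FX).add ((c (tau V z)).mul FY)).add ((c (phi V z)).mul FU)).add
      (((((c (partialX (phi V) z)).add (P.mul (c (partialU (phi V) z)))).sub
        (P.mul ((c (partialX (xi V) z)).add (P.mul (c (partialU (xi V) z)))))).sub
        (F.mul ((c (partialX (tau V) z)).add (P.mul (c (partialU (tau V) z)))))).mul FP)))).eq_zero
    (by
      filter_upwards [eventually_lift_mem hD h0] with p hp
      exact hV.determining_first hS.isOpen_U hS.isOpen_W hF hp)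
  simp only [f1, f2, f3]
  refine ⟨by linear_combination e0, by linear_combination -e1, by linear_combination -e2⟩

/-- Each of the three coefficients of powers of `u_11` in `determining_second` contributes its
orders 0 and 1 in `p`; order 2 is discarded. -/
theorem IsSymmetry.separated_second (hV : S.IsSymmetry V) (hS : S.IsSmooth) {z : Pt 𝕜}
    (hz : z ∈ S.U) :
    partialU (xi V) z + S.f1 z * partialU (tau V) z + S.f2 z * partialX (tau V) z = 0 ∧
    2 * S.f2 z * partialU (tau V) z + S.f3 z * partialX (tau V) z = 0 ∧
    partialX (partialU (phi V)) z = partialX (partialX (xi V)) z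
      + S.f1 z * partialX (partialX (tau V)) z + 2 * partialX S.f1 z * partialX (tau V) z ∧
    partialU (partialU (phi V)) z = 3 * partialX (partialU (xi V)) z
      + 3 * S.f1 z * partialX (partialU (tau V)) z + S.f2 z * partialX (partialX (tau V)) z
      + 3 * partialX S.f1 z * partialU (tau V) z
      + (2 * partialX S.f2 z + 3 * partialU S.f1 z) * partialX (tau V) z ∧
    partialX (partialX (partialX (phi V))) z = -S.g0 z * partialU (phi V) z
      + 3 * S.g0 z * partialX (xi V) z + 3 * S.g0 z * S.f1 z * partialX (tau V) z
      + (xi V z * partialX S.g0 z + tau V z * partialY S.g0 z + phi V z * partialU S.g0 z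
        + partialX (phi V) z * S.g1 z) ∧
    3 * partialX (partialX (partialU (phi V))) z = partialX (partialX (partialX (xi V))) z
      + S.f1 z * partialX (partialX (partialX (tau V))) z
      - S.g1 z * partialU (phi V) z + 4 * S.g0 z * partialU (xi V) z
      + 3 * S.g1 z * partialX (xi V) z + 4 * S.f1 z * S.g0 z * partialU (tau V) z
      + 3 * partialX S.f1 z * partialX (partialX (tau V)) z
      + 3 * (S.g0 z * S.f2 z + S.f1 z * S.g1 z + partialX (partialX S.f1) z) * partialX (tau V) z
      + (xi V z * partialX S.g1 z + tau V z * partialY S.g1 z + phi V z * partialU S.g1 z)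
      + (partialU (phi V) z - partialX (xi V) z - S.f1 z * partialX (tau V) z) * S.g1 z
      + partialX (phi V) z * S.g2 z := by
  have hU := hS.isOpen_U
  have hD := hS.isOpen_dom
  have hF := hS.contDiffOn_rhs
  have hG := hS.contDiffOn_G_dom
  have h0 := hS.lift_mem_dom hz
  have hFX := ContDiffOn.pd hD hF (1, 0, 0, 0)
  have hFU := ContDiffOn.pd hD hF (0, 0, 1, 0)
  have hFP := ContDiffOn.pd hD hF (0, 0, 0, 1)
  have c := HasTaylor.const (𝕜 := 𝕜)
  have P := HasTaylor.id (𝕜 := 𝕜)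
  have F := hasTaylor_lift hD hF h0
  have FX := hasTaylor_qX hD hF h0
  have FU := hasTaylor_qU hD hF h0
  have FP := hasTaylor_lift hD hFP h0
  have FPP := hasTaylor_lift hD (ContDiffOn.pd hD hFP (0, 0, 0, 1)) h0
  have FXP := hasTaylor_qX hD hFP h0
  have FUP := hasTaylor_qU hD hFP h0
  have FXX := hasTaylor_qX hD hFX h0
  have FUX := hasTaylor_qU hD hFX h0
  have FUU := hasTaylor_qU hD hFU h0
  have G := hasTaylor_lift hD hG h0
  have GX := hasTaylor_qX hD hG h0
  have GY := hasTaylor_qY hD hG h0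
  have GU := hasTaylor_qU hD hG h0
  have GP := hasTaylor_lift hD (ContDiffOn.pd hD hG (0, 0, 0, 1)) h0
  have zX : ∀ w ∈ S.U, partialX (slice S.rhs) w = 0 := fun _ =>
    pd_eq_zero_of_eq_zero hU (fun z _ => S.slice_rhs z) _
  have zU : partialU (slice S.rhs) z = 0 :=
    pd_eq_zero_of_eq_zero hU (fun z _ => S.slice_rhs z) _ hz
  have sX : ∀ w ∈ S.U, slice (qX S.rhs) w = 0 := fun w hw => by
    rw [slice_qX hD hF (hS.lift_mem_dom hw), zX w hw]
  have zXX : partialX (slice (qX S.rhs)) z = 0 := pd_eq_zero_of_eq_zero hU sX _ hz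
  have zUX : partialU (slice (qX S.rhs)) z = 0 := pd_eq_zero_of_eq_zero hU sX _ hz
  have sXP : partialX (slice (qP (qX S.rhs))) z = partialX (partialX S.f1) z := by
    refine partialX_congr hU (fun w hw => ?_) hz
    have e : slice (qP (qX S.rhs)) w = slice (qX (qP S.rhs)) w :=
      pd_comm hD hF _ _ (hS.lift_mem_dom hw)
    rw [e, slice_qX hD hFP (hS.lift_mem_dom hw), f1]
  rw [slice_rhs] at F
  rw [zX z hz] at FX
  rw [zU] at FU
  rw [zXX, sXP] at FXX
  rw [zUX] at FUX
  have hdet := fun p (hp : lift z p ∈ S.dom) =>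
    hV.determining_second hU hS.isOpen_W hF hG hp
  have hev := eventually_lift_mem hD h0
  obtain ⟨a0, a1, -⟩ := (((c (partialU (xi V) z)).add (FP.mul (c (partialU (tau V) z)))).add
    (FPP.mul ((c (partialX (tau V) z)).add (P.mul (c (partialU (tau V) z)))))).eq_zero
    (by filter_upwards [hev] with p hp using (hdet p hp).1)
  have TX := (c (partialX (tau V) z)).add (P.mul (c (partialU (tau V) z)))
  have TXX := ((c (partialX (partialX (tau V)) z)).add
    (((c 2).mul P).mul (c (partialX (partialU (tau V)) z)))).add
    ((P.mul P).mul (c (partialU (partialU (tau V)) z)))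
  obtain ⟨b0, b1, -⟩ := (((((((c (partialX (partialU (phi V)) z)).add
      (P.mul (c (partialU (partialU (phi V)) z)))).sub
    (P.mul ((c (partialX (partialU (xi V)) z)).add
      (P.mul (c (partialU (partialU (xi V)) z)))))).sub
    (((c (partialX (partialX (xi V)) z)).add
      (((c 2).mul P).mul (c (partialX (partialU (xi V)) z)))).add
      ((P.mul P).mul (c (partialU (partialU (xi V)) z))))).sub
    (F.mul ((c (partialX (partialU (tau V)) z)).add
      (P.mul (c (partialU (partialU (tau V)) z)))))).sub
    (FP.mul TXX)).sub
    ((FX.add (P.mul FU)).mul (c (partialU (tau V) z)))).sub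
    (((((c 2).mul FXP).add FU).add (((c 2).mul P).mul FUP)).mul TX) |>.eq_zero
    (by filter_upwards [hev] with p hp using (hdet p hp).2.1)
  -- The third total derivative of `f` at `u_11 = 0`, `u_111 = G`; it occurs for each of `φ`, `ξ`,
  -- `τ`.
  have cubic := fun f : Pt 𝕜 → 𝕜 => (((c (partialX (partialX (partialX f)) z)).add
    (((c 3).mul P).mul (c (partialX (partialX (partialU f)) z)))).add
    ((((c 3).mul P).mul P).mul (c (partialX (partialU (partialU f)) z)))).add
    (((P.mul P).mul P).mul (c (partialU (partialU (partialU f)) z))) |>.add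
    (G.mul (c (partialU f z)))
  obtain ⟨d0, d1, -⟩ := ((((((cubic (phi V)).sub (P.mul (cubic (xi V)))).sub
    (((c 3).mul G).mul ((c (partialX (xi V) z)).add (P.mul (c (partialU (xi V) z)))))).sub
    (F.mul (cubic (tau V)))).sub
    (((c 3).mul (FX.add (P.mul FU))).mul TXX)).sub
    (((c 3).mul ((((G.mul FP).add FXX).add (((c 2).mul P).mul FUX)).add
      ((P.mul P).mul FUU))).mul TX)).sub
    (((((c (xi V z)).mul GX).add ((c (tau V z)).mul GY)).add ((c (phi V z)).mul GU)).add
      (((((c (partialX (phi V) z)).add (P.mul (c (partialU (phi V) z)))).sub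
        (P.mul ((c (partialX (xi V) z)).add (P.mul (c (partialU (xi V) z)))))).sub
        (F.mul TX)).mul GP)) |>.eq_zero
    (by filter_upwards [hev] with p hp using (hdet p hp).2.2)
  simp only [f1, f2, f3, g0, g1, g2] at *
  refine ⟨by linear_combination a0, by linear_combination a1, by linear_combination b0,
    by linear_combination b1, by linear_combination d0, by linear_combination d1⟩

end System

end

end LieSymmetry

/-! ### Linear combinations with smooth coefficients. -/

namespace LieSymmetry

noncomputable section

variable {𝕜 : Type*} [RCLike 𝕜]
variable {E : Type*} [NormedAddCommGroup E] [NormedSpace 𝕜 E]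

/-- On `O`, the function `f` is a linear combination of the `w i` with smooth coefficients. -/
def InSpan {ι : Type*} [Fintype ι] (O : Set E) (w : ι → E → 𝕜) (f : E → 𝕜) : Prop :=
  ∃ c : ι → E → 𝕜, (∀ i, ContDiffOn 𝕜 ∞ (c i) O) ∧ ∀ z ∈ O, f z = ∑ i, c i z * w i z

namespace InSpan

variable {ι κ : Type*} [Fintype ι] [Fintype κ] {O : Set E} {w : ι → E → 𝕜} {w' : κ → E → 𝕜}
  {f g a : E → 𝕜}

theorem congr (hf : InSpan O w f) (h : ∀ z ∈ O, g z = f z) : InSpan O w g := by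
  obtain ⟨c, hc, e⟩ := hf
  exact ⟨c, hc, fun z hz => (h z hz).trans (e z hz)⟩

theorem mem (i : ι) : InSpan O w (w i) := by
  classical
  refine ⟨fun j _ => if j = i then 1 else 0, fun _ => contDiffOn_const, fun z _ => ?_⟩
  simp

theorem add (hf : InSpan O w f) (hg : InSpan O w g) : InSpan O w (fun z => f z + g z) := by
  obtain ⟨c, hc, e⟩ := hf
  obtain ⟨d, hd, e'⟩ := hg
  refine ⟨fun i z => c i z + d i z, fun i => (hc i).add (hd i), fun z hz => ?_⟩
  simp only [e z hz, e' z hz, add_mul, Finset.sum_add_distrib]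

theorem mul (ha : ContDiffOn 𝕜 ∞ a O) (hf : InSpan O w f) : InSpan O w (fun z => a z * f z) := by
  obtain ⟨c, hc, e⟩ := hf
  refine ⟨fun i z => a z * c i z, fun i => ha.mul (hc i), fun z hz => ?_⟩
  simp only [e z hz, Finset.mul_sum, mul_assoc]

theorem mul_right (hf : InSpan O w f) (ha : ContDiffOn 𝕜 ∞ a O) :
    InSpan O w (fun z => f z * a z) :=
  (mul ha hf).congr fun _ _ => mul_comm _ _

theorem const_mul (k : 𝕜) (hf : InSpan O w f) : InSpan O w (fun z => k * f z) :=
  mul contDiffOn_const hf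

theorem sub (hf : InSpan O w f) (hg : InSpan O w g) : InSpan O w (fun z => f z - g z) :=
  (hf.add (const_mul (-1) hg)).congr fun _ _ => by ring

theorem zero : InSpan O w (fun _ => 0) :=
  ⟨fun _ _ => 0, fun _ => contDiffOn_const, fun _ _ => by simp⟩

theorem sum {μ : Type*} (s : Finset μ) {F : μ → E → 𝕜} (h : ∀ i, InSpan O w (F i)) :
    InSpan O w (fun z => ∑ i ∈ s, F i z) := by
  classical
  induction s using Finset.induction_on with
  | empty => simpa using zero
  | insert i s hi ih => simpa [Finset.sum_insert hi] using (h i).add ih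

theorem trans (hf : InSpan O w f) (h : ∀ i, InSpan O w' (w i)) : InSpan O w' f := by
  obtain ⟨c, hc, e⟩ := hf
  exact (sum Finset.univ fun i => mul (hc i) (h i)).congr e

/-- By the Leibniz rule both the `w i` and their derivatives appear. The larger family `w'` absorbs
the derivatives, as `frame` does for `frame1`. -/
theorem pd (hO : IsOpen O) (v : E) (hf : InSpan O w f) (hd : ∀ i, ContDiffOn 𝕜 ∞ (w i) O)
    (h : ∀ i, InSpan O w' (w i)) (h' : ∀ i, InSpan O w' (pd v (w i))) :
    InSpan O w' (LieSymmetry.pd v f) := by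
  obtain ⟨c, hc, e⟩ := hf
  refine (sum Finset.univ fun i =>
    (mul (ContDiffOn.pd hO (hc i) v) (h i)).add (mul (hc i) (h' i))).congr fun z hz => ?_
  rw [pd_congr hO e v hz, LieSymmetry.pd]
  have dc := fun i => differentiableAt_of_contDiffOn hO (hc i) hz
  have dw := fun i => differentiableAt_of_contDiffOn hO (hd i) hz
  rw [fderiv_fun_sum fun i _ => (dc i).fun_mul (dw i), sum_apply]
  refine Finset.sum_congr rfl fun i _ => ?_
  rw [fderiv_fun_mul (dc i) (dw i)]
  simp only [LieSymmetry.pd, add_apply, FunLike.coe_smul, Pi.smul_apply, smul_eq_mul]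
  ring

end InSpan

theorem partialX_mul {U : Set (Pt 𝕜)} (hU : IsOpen U) {a f : Pt 𝕜 → 𝕜}
    (ha : ContDiffOn 𝕜 ∞ a U) (hf : ContDiffOn 𝕜 ∞ f U) {z : Pt 𝕜} (hz : z ∈ U) :
    partialX (fun z => a z * f z) z = partialX a z * f z + a z * partialX f z :=
  (((hasAlongOn_pd hU ha _).mul (hasAlongOn_pd hU hf _)) z hz).2

theorem partialU_mul {U : Set (Pt 𝕜)} (hU : IsOpen U) {a f : Pt 𝕜 → 𝕜}
    (ha : ContDiffOn 𝕜 ∞ a U) (hf : ContDiffOn 𝕜 ∞ f U) {z : Pt 𝕜} (hz : z ∈ U) :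
    partialU (fun z => a z * f z) z = partialU a z * f z + a z * partialU f z :=
  (((hasAlongOn_pd hU ha _).mul (hasAlongOn_pd hU hf _)) z hz).2

theorem partialX_add {U : Set (Pt 𝕜)} (hU : IsOpen U) {a f : Pt 𝕜 → 𝕜}
    (ha : ContDiffOn 𝕜 ∞ a U) (hf : ContDiffOn 𝕜 ∞ f U) {z : Pt 𝕜} (hz : z ∈ U) :
    partialX (fun z => a z + f z) z = partialX a z + partialX f z :=
  (((hasAlongOn_pd hU ha _).add (hasAlongOn_pd hU hf _)) z hz).2

theorem partialU_add {U : Set (Pt 𝕜)} (hU : IsOpen U) {a f : Pt 𝕜 → 𝕜}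
    (ha : ContDiffOn 𝕜 ∞ a U) (hf : ContDiffOn 𝕜 ∞ f U) {z : Pt 𝕜} (hz : z ∈ U) :
    partialU (fun z => a z + f z) z = partialU a z + partialU f z :=
  (((hasAlongOn_pd hU ha _).add (hasAlongOn_pd hU hf _)) z hz).2

/-- The seven initial Taylor coefficients of order at most one, as functions on `U`. -/
def frame1 (V : Pt 𝕜 → Pt 𝕜) : Fin 7 → Pt 𝕜 → 𝕜 :=
  ![xi V, tau V, phi V, partialX (xi V), partialX (tau V), partialX (phi V), partialU (phi V)]

/-- The ten initial Taylor coefficients, as functions on `U`. -/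
def frame (V : Pt 𝕜 → Pt 𝕜) : Fin 10 → Pt 𝕜 → 𝕜 :=
  ![xi V, tau V, phi V, partialX (xi V), partialX (tau V), partialX (phi V), partialU (phi V),
    partialX (partialX (xi V)), partialX (partialX (tau V)), partialX (partialX (phi V))]

theorem frame_apply (V : Pt 𝕜 → Pt 𝕜) (i : Fin 10) (z : Pt 𝕜) :
    frame V i z = initialTaylorCoeffs V z i := by
  fin_cases i <;> rfl

theorem contDiffOn_frame1 {U : Set (Pt 𝕜)} (hU : IsOpen U) {V : Pt 𝕜 → Pt 𝕜}
    (hV : ContDiffOn 𝕜 ∞ V U) (i : Fin 7) : ContDiffOn 𝕜 ∞ (frame1 V i) U := by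
  have hx := contDiffOn_xi hV
  have ht := contDiffOn_tau hV
  have hp := contDiffOn_phi hV
  fin_cases i
  exacts [hx, ht, hp, contDiffOn_partialX hU hx, contDiffOn_partialX hU ht,
    contDiffOn_partialX hU hp, contDiffOn_partialU hU hp]

theorem contDiffOn_frame {U : Set (Pt 𝕜)} (hU : IsOpen U) {V : Pt 𝕜 → Pt 𝕜}
    (hV : ContDiffOn 𝕜 ∞ V U) (i : Fin 10) : ContDiffOn 𝕜 ∞ (frame V i) U := by
  have hx := contDiffOn_xi hV
  have ht := contDiffOn_tau hV
  have hp := contDiffOn_phi hV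
  fin_cases i
  exacts [hx, ht, hp, contDiffOn_partialX hU hx, contDiffOn_partialX hU ht,
    contDiffOn_partialX hU hp, contDiffOn_partialU hU hp,
    contDiffOn_partialX hU (contDiffOn_partialX hU hx),
    contDiffOn_partialX hU (contDiffOn_partialX hU ht),
    contDiffOn_partialX hU (contDiffOn_partialX hU hp)]

/-! ### Closing the system: derivatives of the ten coefficients. -/

namespace System

variable {S : System 𝕜} {V : Pt 𝕜 → Pt 𝕜}

theorem IsSmooth.contDiffOn_slice_rhs (hS : S.IsSmooth) :
    ContDiffOn 𝕜 ∞ S.f1 S.U ∧ ContDiffOn 𝕜 ∞ S.f2 S.U ∧ ContDiffOn 𝕜 ∞ S.f3 S.U := by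
  have hD := hS.isOpen_dom
  have h1 := ContDiffOn.pd hD hS.contDiffOn_rhs (0, 0, 0, 1)
  have h2 := ContDiffOn.pd hD h1 (0, 0, 0, 1)
  have h3 := ContDiffOn.pd hD h2 (0, 0, 0, 1)
  have m : ∀ z ∈ S.U, lift z 0 ∈ S.dom := fun _ hz => hS.lift_mem_dom hz
  exact ⟨contDiffOn_slice m h1, contDiffOn_slice m h2, contDiffOn_slice m h3⟩

theorem IsSmooth.contDiffOn_slice_G (hS : S.IsSmooth) :
    ContDiffOn 𝕜 ∞ S.g0 S.U ∧ ContDiffOn 𝕜 ∞ S.g1 S.U ∧ ContDiffOn 𝕜 ∞ S.g2 S.U := by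
  have hD := hS.isOpen_dom
  have h1 := ContDiffOn.pd hD hS.contDiffOn_G_dom (0, 0, 0, 1)
  have h2 := ContDiffOn.pd hD h1 (0, 0, 0, 1)
  have m : ∀ z ∈ S.U, lift z 0 ∈ S.dom := fun _ hz => hS.lift_mem_dom hz
  exact ⟨contDiffOn_slice m hS.contDiffOn_G_dom, contDiffOn_slice m h1, contDiffOn_slice m h2⟩

theorem inSpan_frame_of_frame1 {f : Pt 𝕜 → 𝕜} {U : Set (Pt 𝕜)}
    (hf : InSpan U (frame1 V) f) : InSpan U (frame V) f := by
  refine hf.trans fun i => ?_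
  have h : frame1 V i = frame V (i.castLE (by decide)) := by fin_cases i <;> rfl
  rw [h]
  exact InSpan.mem _

/-- All first derivatives of `ξ`, `τ`, `φ` are combinations of `frame1`. -/
theorem IsSymmetry.inSpan_frame1 (hV : S.IsSymmetry V) (hS : S.IsSmooth)
    (hne : ∀ z ∈ S.U, S.f2 z ≠ 0) :
    InSpan S.U (frame1 V) (partialU (xi V)) ∧ InSpan S.U (frame1 V) (partialU (tau V)) ∧
    InSpan S.U (frame1 V) (partialY (xi V)) ∧ InSpan S.U (frame1 V) (partialY (tau V)) ∧
    InSpan S.U (frame1 V) (partialY (phi V)) := by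
  obtain ⟨s1, s2, s3⟩ := hS.contDiffOn_slice_rhs
  have hU := hS.isOpen_U
  have si := s2.inv hne
  have x : InSpan S.U (frame1 V) (xi V) := InSpan.mem 0
  have t : InSpan S.U (frame1 V) (tau V) := InSpan.mem 1
  have f : InSpan S.U (frame1 V) (phi V) := InSpan.mem 2
  have xX : InSpan S.U (frame1 V) (partialX (xi V)) := InSpan.mem 3
  have tX : InSpan S.U (frame1 V) (partialX (tau V)) := InSpan.mem 4
  have fX : InSpan S.U (frame1 V) (partialX (phi V)) := InSpan.mem 5
  have fU : InSpan S.U (frame1 V) (partialU (phi V)) := InSpan.mem 6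
  have vec : ∀ a : Pt 𝕜 → 𝕜, ContDiffOn 𝕜 ∞ a S.U → InSpan S.U (frame1 V) fun z =>
      xi V z * partialX a z + tau V z * partialY a z + phi V z * partialU a z := fun a ha =>
    ((x.mul_right (contDiffOn_partialX hU ha)).add (t.mul_right (contDiffOn_partialY hU ha))).add
      (f.mul_right (contDiffOn_partialU hU ha))
  have tU : InSpan S.U (frame1 V) (partialU (tau V)) := by
    refine (InSpan.const_mul (-1 / 2) (InSpan.mul si (InSpan.mul s3 tX))).congr fun z hz => ?_
    have h := (hV.separated_second hS hz).2.1
    have h2 := hne z hz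
    simp only [Pi.inv_apply]
    field_simp
    linear_combination h
  have xU : InSpan S.U (frame1 V) (partialU (xi V)) :=
    (InSpan.const_mul (-1) ((InSpan.mul s1 tU).add (InSpan.mul s2 tX))).congr fun z hz => by
      linear_combination (hV.separated_second hS hz).1
  have tY : InSpan S.U (frame1 V) (partialY (tau V)) := by
    refine (InSpan.mul si ((((InSpan.mul s1 (InSpan.mul s2 (InSpan.const_mul 3 tX))).add
      (InSpan.const_mul 2 (InSpan.mul s2 xX))).sub (InSpan.mul s2 fU)).sub
      ((vec _ s2).add (InSpan.mul s3 fX)))).congr fun z hz => ?_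
    have h := (hV.separated_first hS hz).2.2
    have h2 := hne z hz
    simp only [Pi.inv_apply]
    field_simp
    linear_combination h
  have xY : InSpan S.U (frame1 V) (partialY (xi V)) :=
    ((((InSpan.mul s1 xX).add (InSpan.mul s1 (InSpan.mul s1 tX))).sub (InSpan.mul s1 tY)).sub
      ((vec _ s1).add (InSpan.mul s2 fX))).congr fun z hz => by
      linear_combination (hV.separated_first hS hz).2.1
  exact ⟨xU, tU, xY, tY, (InSpan.mul s1 fX).congr fun z hz => (hV.separated_first hS hz).1⟩

end System

end

end LieSymmetry

namespace LieSymmetry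

noncomputable section

variable {𝕜 : Type*} [RCLike 𝕜]

namespace System

variable {S : System 𝕜} {V : Pt 𝕜 → Pt 𝕜}

/-- The partial derivatives of a combination of `frame1` are combinations of
`frame`. -/
theorem IsSymmetry.inSpan_partial_of_frame1 (hV : S.IsSymmetry V) (hS : S.IsSmooth)
    (hne : ∀ z ∈ S.U, S.f2 z ≠ 0) {f : Pt 𝕜 → 𝕜} (hf : InSpan S.U (frame1 V) f) :
    InSpan S.U (frame V) (partialX f) ∧ InSpan S.U (frame V) (partialU f) ∧
      InSpan S.U (frame V) (partialY f) := by
  obtain ⟨s1, s2, s3⟩ := hS.contDiffOn_slice_rhs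
  have hU := hS.isOpen_U
  obtain ⟨xU, tU, xY, tY, fY⟩ := hV.inSpan_frame1 hS hne
  have hx := contDiffOn_xi hV.1
  have ht := contDiffOn_tau hV.1
  have hp := contDiffOn_phi hV.1
  have c1 := contDiffOn_frame1 hU hV.1
  have up : ∀ i, InSpan S.U (frame V) (frame1 V i) := fun i =>
    inSpan_frame_of_frame1 (InSpan.mem i)
  have xX : InSpan S.U (frame V) (partialX (xi V)) := InSpan.mem 3
  have tX : InSpan S.U (frame V) (partialX (tau V)) := InSpan.mem 4
  have fX : InSpan S.U (frame V) (partialX (phi V)) := InSpan.mem 5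
  have fU : InSpan S.U (frame V) (partialU (phi V)) := InSpan.mem 6
  have xXX : InSpan S.U (frame V) (partialX (partialX (xi V))) := InSpan.mem 7
  have tXX : InSpan S.U (frame V) (partialX (partialX (tau V))) := InSpan.mem 8
  have fXX : InSpan S.U (frame V) (partialX (partialX (phi V))) := InSpan.mem 9
  -- `φ_u` is the only member of `frame1` whose `x`-derivative is not itself in `frame`.
  have fXU : InSpan S.U (frame V) (partialX (partialU (phi V))) :=
    ((xXX.add (InSpan.mul s1 tXX)).add
      (InSpan.const_mul 2 (InSpan.mul (contDiffOn_partialX hU s1) tX))).congr fun z hz => by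
      rw [(hV.separated_second hS hz).2.2.1, mul_assoc]
  have hX : ∀ {f : Pt 𝕜 → 𝕜}, InSpan S.U (frame1 V) f → InSpan S.U (frame V) (partialX f) :=
    fun hf => hf.pd hU (1, 0, 0) c1 up fun i => by
      fin_cases i
      exacts [xX, tX, fX, xXX, tXX, fXX, fXU]
  -- The formula for `φ_uu` contains `ξ_xu` and `τ_xu`, which are `x`-derivatives of combinations of
  -- `frame1`; so `hX` has to come before.
  have fUU : InSpan S.U (frame V) (partialU (partialU (phi V))) :=
    (((((InSpan.const_mul 3 (hX xU)).add (InSpan.const_mul 3 (InSpan.mul s1 (hX tU)))).add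
      (InSpan.mul s2 tXX)).add (InSpan.const_mul 3 (InSpan.mul (contDiffOn_partialX hU s1)
        (inSpan_frame_of_frame1 tU)))).add
      ((InSpan.const_mul 2 (InSpan.mul (contDiffOn_partialX hU s2) tX)).add
        (InSpan.const_mul 3 (InSpan.mul (contDiffOn_partialU hU s1) tX)))).congr fun z hz => by
      rw [(hV.separated_second hS hz).2.2.2.1]
      ring
  have hX' : ∀ {f : Pt 𝕜 → 𝕜}, InSpan S.U (frame1 V) f → InSpan S.U (frame V) (partialU f) :=
    fun hf => hf.pd hU (0, 0, 1) c1 up fun i => by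
      fin_cases i
      exacts [inSpan_frame_of_frame1 xU, inSpan_frame_of_frame1 tU, fU,
        (hX xU).congr fun z hz => partialU_partialX hU hx hz,
        (hX tU).congr fun z hz => partialU_partialX hU ht hz,
        fXU.congr fun z hz => partialU_partialX hU hp hz, fUU]
  refine ⟨hX hf, hX' hf, hf.pd hU (0, 1, 0) c1 up fun i => ?_⟩
  fin_cases i
  exacts [inSpan_frame_of_frame1 xY, inSpan_frame_of_frame1 tY, inSpan_frame_of_frame1 fY,
    (hX xY).congr fun z hz => partialY_partialX hU hx hz,
    (hX tY).congr fun z hz => partialY_partialX hU ht hz,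
    (hX fY).congr fun z hz => partialY_partialX hU hp hz,
    (hX' fY).congr fun z hz => partialY_partialU hU hp hz]

/-- The third derivatives `ξ_xxx`, `τ_xxx`, `φ_xxx`, `φ_xxu` are combinations of `frame`. -/
theorem IsSymmetry.inSpan_third (hV : S.IsSymmetry V) (hS : S.IsSmooth)
    (hne : ∀ z ∈ S.U, S.f2 z ≠ 0) :
    InSpan S.U (frame V) (partialX (partialX (partialX (xi V)))) ∧
    InSpan S.U (frame V) (partialX (partialX (partialX (tau V)))) ∧
    InSpan S.U (frame V) (partialX (partialX (partialX (phi V)))) ∧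
    InSpan S.U (frame V) (partialX (partialX (partialU (phi V)))) := by
  obtain ⟨s1, s2, s3⟩ := hS.contDiffOn_slice_rhs
  obtain ⟨r0, r1, r2⟩ := hS.contDiffOn_slice_G
  have hU := hS.isOpen_U
  have hx := contDiffOn_xi hV.1
  have ht := contDiffOn_tau hV.1
  have hp := contDiffOn_phi hV.1
  obtain ⟨xU, tU, -⟩ := hV.inSpan_frame1 hS hne
  have hX := fun {f : Pt 𝕜 → 𝕜} (hf : InSpan S.U (frame1 V) f) =>
    (hV.inSpan_partial_of_frame1 hS hne hf).1
  have hX' := fun {f : Pt 𝕜 → 𝕜} (hf : InSpan S.U (frame1 V) f) =>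
    (hV.inSpan_partial_of_frame1 hS hne hf).2.1
  have x : InSpan S.U (frame V) (xi V) := InSpan.mem 0
  have t : InSpan S.U (frame V) (tau V) := InSpan.mem 1
  have f : InSpan S.U (frame V) (phi V) := InSpan.mem 2
  have xX : InSpan S.U (frame V) (partialX (xi V)) := InSpan.mem 3
  have tX : InSpan S.U (frame V) (partialX (tau V)) := InSpan.mem 4
  have tX1 : InSpan S.U (frame1 V) (partialX (tau V)) := InSpan.mem 4
  have fX : InSpan S.U (frame V) (partialX (phi V)) := InSpan.mem 5
  have fU : InSpan S.U (frame V) (partialU (phi V)) := InSpan.mem 6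
  have tXX : InSpan S.U (frame V) (partialX (partialX (tau V))) := InSpan.mem 8
  have vec : ∀ a : Pt 𝕜 → 𝕜, ContDiffOn 𝕜 ∞ a S.U → InSpan S.U (frame V) fun z =>
      xi V z * partialX a z + tau V z * partialY a z + phi V z * partialU a z := fun a ha =>
    ((x.mul_right (contDiffOn_partialX hU ha)).add (t.mul_right (contDiffOn_partialY hU ha))).add
      (f.mul_right (contDiffOn_partialU hU ha))
  have fXXX : InSpan S.U (frame V) (partialX (partialX (partialX (phi V)))) :=
    (((InSpan.mul r0 ((InSpan.const_mul 3 xX).sub fU)).add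
      (InSpan.const_mul 3 (InSpan.mul r0 (InSpan.mul s1 tX)))).add
      ((vec _ r0).add (InSpan.mul r1 fX))).congr fun z hz => by
      rw [(hV.separated_second hS hz).2.2.2.2.1]
      ring
  have cX := fun {a : Pt 𝕜 → 𝕜} (ha : ContDiffOn 𝕜 ∞ a S.U) => contDiffOn_partialX hU ha
  have cU := fun {a : Pt 𝕜 → 𝕜} (ha : ContDiffOn 𝕜 ∞ a S.U) => contDiffOn_partialU hU ha
  -- derivatives of the formula for `φ_xu`
  have c2 : ContDiffOn 𝕜 ∞ (fun z => 2 * partialX S.f1 z) S.U := contDiffOn_const.mul (cX s1)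
  have mixed : ∀ z ∈ S.U, partialX (partialU (phi V)) z = partialX (partialX (xi V)) z
      + (S.f1 z * partialX (partialX (tau V)) z
        + 2 * partialX S.f1 z * partialX (tau V) z) := fun z hz => by
    rw [(hV.separated_second hS hz).2.2.1, add_assoc]
  have mixedX : ∀ z ∈ S.U, partialX (partialX (partialU (phi V))) z
      = partialX (partialX (partialX (xi V))) z
        + (partialX S.f1 z * partialX (partialX (tau V)) z
          + S.f1 z * partialX (partialX (partialX (tau V))) z
        + partialX (fun z => 2 * partialX S.f1 z * partialX (tau V) z) z) := fun z hz => by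
    rw [partialX_congr hU mixed hz, partialX_add hU (cX (cX hx))
      ((s1.mul (cX (cX ht))).add (c2.mul (cX ht))) hz,
      partialX_add hU (s1.mul (cX (cX ht))) (c2.mul (cX ht)) hz,
      partialX_mul hU s1 (cX (cX ht)) hz]
  have mixedU : ∀ z ∈ S.U, partialX (partialU (partialU (phi V))) z
      = partialX (partialX (partialU (xi V))) z
        + (partialU S.f1 z * partialX (partialX (tau V)) z
          + S.f1 z * partialX (partialX (partialU (tau V))) z
        + partialU (fun z => 2 * partialX S.f1 z * partialX (tau V) z) z) := fun z hz => by
    rw [← partialU_partialX hU (cU hp) hz, ← partialU_partialX_partialX hU hx hz,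
      ← partialU_partialX_partialX hU ht hz, partialU_congr hU mixed hz,
      partialU_add hU (cX (cX hx)) ((s1.mul (cX (cX ht))).add (c2.mul (cX ht))) hz,
      partialU_add hU (s1.mul (cX (cX ht))) (c2.mul (cX ht)) hz,
      partialU_mul hU s1 (cX (cX ht)) hz]
  -- the derivative in `x` of the formula for `φ_uu`
  have c3 : ContDiffOn 𝕜 ∞ (fun z => 3 * S.f1 z) S.U := contDiffOn_const.mul s1
  -- The part of the formula for `φ_uu` that contains only first derivatives of `τ`; `hX` handles
  -- its `x`-derivative as a whole.
  let n : Pt 𝕜 → 𝕜 := fun z => 3 * (partialX S.f1 z * partialU (tau V) z)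
      + (2 * (partialX S.f2 z * partialX (tau V) z) + 3 * (partialU S.f1 z * partialX (tau V) z))
  have hn : InSpan S.U (frame1 V) n := (InSpan.const_mul 3 (InSpan.mul (cX s1) tU)).add
    ((InSpan.const_mul 2 (InSpan.mul (cX s2) tX1)).add
      (InSpan.const_mul 3 (InSpan.mul (cU s1) tX1)))
  have cn : ContDiffOn 𝕜 ∞ n S.U := (contDiffOn_const.mul ((cX s1).mul (cU ht))).add
    ((contDiffOn_const.mul ((cX s2).mul (cX ht))).add
      (contDiffOn_const.mul ((cU s1).mul (cX ht))))
  have secondX : ∀ z ∈ S.U, partialX (partialU (partialU (phi V))) z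
      = 3 * partialX (partialX (partialU (xi V))) z
        + (3 * partialX S.f1 z * partialX (partialU (tau V)) z
          + 3 * S.f1 z * partialX (partialX (partialU (tau V))) z
        + (partialX S.f2 z * partialX (partialX (tau V)) z
          + S.f2 z * partialX (partialX (partialX (tau V))) z + partialX n z)) := fun z hz => by
    have e : ∀ z ∈ S.U, partialU (partialU (phi V)) z = 3 * partialX (partialU (xi V)) z
        + (3 * S.f1 z * partialX (partialU (tau V)) z
        + (S.f2 z * partialX (partialX (tau V)) z + n z)) := fun z hz => by
      rw [(hV.separated_second hS hz).2.2.2.1]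
      ring
    have k : ∀ c : 𝕜, ∀ {a : Pt 𝕜 → 𝕜}, ContDiffOn 𝕜 ∞ a S.U →
        partialX (fun z => c * a z) z = c * partialX a z := fun c a ha => by
      rw [partialX_mul hU contDiffOn_const ha hz]
      simp [partialX]
    rw [partialX_congr hU e hz, partialX_add hU (contDiffOn_const.mul (cX (cU hx)))
      ((c3.mul (cX (cU ht))).add ((s2.mul (cX (cX ht))).add cn)) hz,
      partialX_add hU (c3.mul (cX (cU ht))) ((s2.mul (cX (cX ht))).add cn) hz,
      partialX_add hU (s2.mul (cX (cX ht))) cn hz, partialX_mul hU c3 (cX (cU ht)) hz,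
      partialX_mul hU s2 (cX (cX ht)) hz, k 3 (cX (cU hx)), k 3 s1]
  -- the second derivative in `x` of `ξ_u + f1 τ_u + f2 τ_x = 0`
  have relX : ∀ z ∈ S.U, partialX (partialU (xi V)) z
      + (partialX S.f1 z * partialU (tau V) z + S.f1 z * partialX (partialU (tau V)) z
        + (partialX S.f2 z * partialX (tau V) z + S.f2 z * partialX (partialX (tau V)) z)) = 0 :=
    fun z hz => by
    rw [← partialX_mul hU s1 (cU ht) hz, ← partialX_mul hU s2 (cX ht) hz,
      ← partialX_add hU (s1.mul (cU ht)) (s2.mul (cX ht)) hz,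
      ← partialX_add hU (cU hx) ((s1.mul (cU ht)).add (s2.mul (cX ht))) hz]
    refine pd_eq_zero_of_eq_zero hU (fun w hw => ?_) _ hz
    rw [← (hV.separated_second hS hw).1, add_assoc]
  have relXX : ∀ z ∈ S.U, partialX (partialX (partialU (xi V))) z
      + (partialX (fun z => partialX S.f1 z * partialU (tau V) z) z
        + (partialX S.f1 z * partialX (partialU (tau V)) z
          + S.f1 z * partialX (partialX (partialU (tau V))) z)
        + (partialX (fun z => partialX S.f2 z * partialX (tau V) z) z
          + (partialX S.f2 z * partialX (partialX (tau V)) z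
            + S.f2 z * partialX (partialX (partialX (tau V))) z))) = 0 := fun z hz => by
    have d1 := (cX s1).mul (cU ht)
    have d2 := s1.mul (cX (cU ht))
    have d3 := (cX s2).mul (cX ht)
    have d4 := s2.mul (cX (cX ht))
    rw [← partialX_mul hU s1 (cX (cU ht)) hz, ← partialX_mul hU s2 (cX (cX ht)) hz,
      ← partialX_add hU d1 d2 hz, ← partialX_add hU d3 d4 hz,
      ← partialX_add hU (d1.add d2) (d3.add d4) hz,
      ← partialX_add hU (cX (cU hx)) ((d1.add d2).add (d3.add d4)) hz]
    exact pd_eq_zero_of_eq_zero hU relX _ hz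
  have m1 := hX (InSpan.mul c2 tX1)
  have m2 := hX' (InSpan.mul c2 tX1)
  -- In `e2 - e1 + 2 * e3` the terms in `ξ_xxu` and `τ_xxu` cancel, and `f2 τ_xxx` survives with
  -- coefficient `-1 + 2 = 1`.
  have tXXX : InSpan S.U (frame V) (partialX (partialX (partialX (tau V)))) := by
    have h := InSpan.mul (s2.inv hne) (((InSpan.mul (cU s1) tXX).add m2).sub
      (((InSpan.const_mul 3 (InSpan.mul (cX s1) (hX tU))).add
        ((InSpan.mul (cX s2) tXX).add (hX hn))).sub
      (InSpan.const_mul 2 (((hX (InSpan.mul (cX s1) tU)).add (InSpan.mul (cX s1) (hX tU))).add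
        ((hX (InSpan.mul (cX s2) tX1)).add (InSpan.mul (cX s2) tXX))))))
    refine (InSpan.const_mul (-1) h).congr fun z hz => ?_
    have h2 := hne z hz
    have e1 := mixedU z hz
    have e2 := secondX z hz
    have e3 := relXX z hz
    simp only [Pi.inv_apply]
    field_simp
    linear_combination e2 - e1 + 2 * e3
  have xU' := inSpan_frame_of_frame1 xU
  have tU' := inSpan_frame_of_frame1 tU
  -- What remains of the formula for `3 φ_xxu` besides `ξ_xxx + f1 τ_xxx`. The two multiples of `g1
  -- φ_u` cancel, and the coefficients of `g1 ξ_x` and `f1 g1 τ_x` become `3 - 1 = 2`.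
  have rest := ((((((((InSpan.const_mul 4 (InSpan.mul r0 xU')).add
    (InSpan.const_mul 2 (InSpan.mul r1 xX))).add
    (InSpan.const_mul 4 (InSpan.mul s1 (InSpan.mul r0 tU')))).add
    (InSpan.const_mul 3 (InSpan.mul (cX s1) tXX))).add
    (InSpan.const_mul 3 (InSpan.mul ((r0.mul s2).add (cX (cX s1))) tX))).add
    (InSpan.const_mul 2 (InSpan.mul s1 (InSpan.mul r1 tX)))).add (vec _ r1)).add
    (InSpan.mul r2 fX))
  have lead := (InSpan.const_mul (1 / 2) rest).sub
    (InSpan.const_mul (3 / 2) ((InSpan.mul (cX s1) tXX).add m1))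
  -- Eliminating `φ_xxu` leaves `2 (ξ_xxx + f1 τ_xxx)`, so `lead` equals `ξ_xxx + f1 τ_xxx`.
  have xXXX : InSpan S.U (frame V) (partialX (partialX (partialX (xi V)))) :=
    (lead.sub (InSpan.mul s1 tXXX)).congr fun z hz => by
      have e1 := mixedX z hz
      have e2 := (hV.separated_second hS hz).2.2.2.2.2
      linear_combination (3 * e1 - e2) / (-2)
  exact ⟨xXXX, tXXX, fXXX, (xXXX.add (((InSpan.mul (cX s1) tXX).add
    (InSpan.mul s1 tXXX)).add m1)).congr mixedX⟩

/-- Combinations of `frame` are closed under partial derivatives. -/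
theorem IsSymmetry.inSpan_partial_frame (hV : S.IsSymmetry V) (hS : S.IsSmooth)
    (hne : ∀ z ∈ S.U, S.f2 z ≠ 0) (i : Fin 10) :
    InSpan S.U (frame V) (partialX (frame V i)) ∧ InSpan S.U (frame V) (partialY (frame V i)) ∧
      InSpan S.U (frame V) (partialU (frame V i)) := by
  have hU := hS.isOpen_U
  have hx := contDiffOn_xi hV.1
  have ht := contDiffOn_tau hV.1
  have hp := contDiffOn_phi hV.1
  obtain ⟨xU, tU, xY, tY, fY⟩ := hV.inSpan_frame1 hS hne
  obtain ⟨xXXX, tXXX, fXXX, fXXU⟩ := hV.inSpan_third hS hne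
  have d1 := fun i => hV.inSpan_partial_of_frame1 hS hne (InSpan.mem (w := frame1 V) i)
  have dX := fun {f : Pt 𝕜 → 𝕜} (hf : InSpan S.U (frame1 V) f) =>
    (hV.inSpan_partial_of_frame1 hS hne hf).1
  have hX : ∀ i, InSpan S.U (frame V) (partialX (frame V i)) := fun i => by
    fin_cases i
    exacts [(d1 0).1, (d1 1).1, (d1 2).1, (d1 3).1, (d1 4).1, (d1 5).1, (d1 6).1,
      xXXX, tXXX, fXXX]
  -- Two `x`-derivatives need `hX` on all of `frame`, third derivatives included. The
  -- `y`-derivatives of `ξ_xx, τ_xx, φ_xx` are then second `x`-derivatives of `ξ_y, τ_y, φ_y`, and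
  -- similarly for `ξ_xxu, τ_xxu`.
  have dXX : ∀ {f : Pt 𝕜 → 𝕜}, InSpan S.U (frame1 V) f →
      InSpan S.U (frame V) (partialX (partialX f)) := fun hf =>
    (dX hf).pd hU (1, 0, 0) (contDiffOn_frame hU hV.1) InSpan.mem hX
  refine ⟨hX i, ?_, ?_⟩
  · fin_cases i
    exacts [(d1 0).2.2, (d1 1).2.2, (d1 2).2.2, (d1 3).2.2, (d1 4).2.2, (d1 5).2.2, (d1 6).2.2,
      (dXX xY).congr fun z hz => partialY_partialX_partialX hU hx hz,
      (dXX tY).congr fun z hz => partialY_partialX_partialX hU ht hz,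
      (dXX fY).congr fun z hz => partialY_partialX_partialX hU hp hz]
  · fin_cases i
    exacts [(d1 0).2.1, (d1 1).2.1, (d1 2).2.1, (d1 3).2.1, (d1 4).2.1, (d1 5).2.1, (d1 6).2.1,
      (dXX xU).congr fun z hz => partialU_partialX_partialX hU hx hz,
      (dXX tU).congr fun z hz => partialU_partialX_partialX hU ht hz,
      fXXU.congr fun z hz => partialU_partialX_partialX hU hp hz]

end System

end

end LieSymmetry

/-! ### Uniqueness for closed linear systems. -/

namespace LieSymmetry

noncomputable section

variable {𝕜 : Type*} [RCLike 𝕜]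

/-- Continuous coefficients are locally bounded, here by their size at `z₁` plus 1. This gives the
bound needed for Grönwall's inequality. -/
theorem InSpan.eventually_norm_le {E : Type*} [NormedAddCommGroup E] [NormedSpace 𝕜 E]
    {ι : Type*} [Fintype ι] {O : Set E} (hO : IsOpen O) {w : ι → E → 𝕜} {f : E → 𝕜}
    (hf : InSpan O w f) {z₁ : E} (hz₁ : z₁ ∈ O) :
    ∃ K : ℝ, 0 ≤ K ∧ ∀ᶠ z in nhds z₁, ‖f z‖ ≤ K * ‖fun i => w i z‖ := by
  obtain ⟨c, hc, e⟩ := hf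
  refine ⟨∑ i, (‖c i z₁‖ + 1), by positivity, ?_⟩
  have hb : ∀ᶠ z in nhds z₁, ∀ i, ‖c i z‖ ≤ ‖c i z₁‖ + 1 := by
    rw [Filter.eventually_all]
    intro i
    have hcont : ContinuousAt (fun z => ‖c i z‖) z₁ :=
      ((hc i).continuousOn.continuousAt (hO.mem_nhds hz₁)).norm
    filter_upwards [hcont.eventually (gt_mem_nhds (lt_add_one ‖c i z₁‖))] with z hz using le_of_lt hz
  filter_upwards [hb, hO.mem_nhds hz₁] with z hz hzO
  rw [e z hzO, Finset.sum_mul]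
  refine (norm_sum_le _ _).trans (Finset.sum_le_sum fun i _ => ?_)
  rw [norm_mul]
  exact mul_le_mul (hz i) (norm_le_pi_norm (fun i => w i z) i) (norm_nonneg _) (by positivity)

/-- A closed linear system of first-order equations has only the zero solution vanishing at a
point. -/
theorem eq_zero_of_inSpan_partial {ι : Type*} [Fintype ι] {U : Set (Pt 𝕜)} (hU : IsOpen U)
    (hconn : IsPreconnected U) {w : ι → Pt 𝕜 → 𝕜} (hw : ∀ i, ContDiffOn 𝕜 ∞ (w i) U)
    (h : ∀ i, InSpan U w (partialX (w i)) ∧ InSpan U w (partialY (w i)) ∧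
      InSpan U w (partialU (w i)))
    {z₀ : Pt 𝕜} (hz₀ : z₀ ∈ U) (h0 : ∀ i, w i z₀ = 0) : ∀ z ∈ U, ∀ i, w i z = 0 := by
  have local_zero : ∀ z₁ ∈ U, (∀ i, w i z₁ = 0) → ∀ᶠ z in nhds z₁, ∀ i, w i z = 0 := by
    intro z₁ hz₁ h1
    choose a ha hA using fun i => (h i).1.eventually_norm_le hU hz₁
    choose b hb hB using fun i => (h i).2.1.eventually_norm_le hU hz₁
    choose c hc hC using fun i => (h i).2.2.eventually_norm_le hU hz₁
    obtain ⟨ε, hε, hball⟩ := Metric.eventually_nhds_iff_ball.1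
      (((Filter.eventually_all.2 hA).and (Filter.eventually_all.2 hB)).and
        ((Filter.eventually_all.2 hC).and (hU.mem_nhds hz₁)))
    -- One constant that bounds all components, as the maximum norm requires.
    set K : ℝ := ∑ i, (a i + b i + c i) with hK
    have hiK : ∀ i, a i + b i + c i ≤ K := fun i =>
      Finset.single_le_sum (f := fun i => a i + b i + c i)
        (fun i _ => add_nonneg (add_nonneg (ha i) (hb i)) (hc i)) (Finset.mem_univ i)
    have hK0 : 0 ≤ K := Finset.sum_nonneg fun i _ => add_nonneg (add_nonneg (ha i) (hb i)) (hc i)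
    filter_upwards [Metric.ball_mem_nhds z₁ hε] with z hz
    set v := z - z₁ with hv
    have hmem : ∀ t ∈ Set.Icc (0 : ℝ) 1, z₁ + t • v ∈ Metric.ball z₁ ε := by
      intro t ht
      rw [Metric.mem_ball, dist_eq_norm] at hz ⊢
      rw [add_sub_cancel_left, norm_smul, Real.norm_of_nonneg ht.1]
      exact (mul_le_of_le_one_left (norm_nonneg _) ht.2).trans_lt hz
    have hline : ∀ t : ℝ, HasDerivAt (fun t : ℝ => z₁ + t • v) v t := fun t => by
      simpa using ((hasDerivAt_id t).smul_const v).const_add z₁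
    have hder : ∀ t ∈ Set.Icc (0 : ℝ) 1, HasDerivAt (fun t : ℝ => fun i => w i (z₁ + t • v))
        (fun i => fderiv 𝕜 (w i) (z₁ + t • v) v) t := by
      intro t ht
      rw [hasDerivAt_pi]
      intro i
      have hd := (differentiableAt_of_contDiffOn hU (hw i) (hball _ (hmem t ht)).2.2).hasFDerivAt
      exact (hd.restrictScalars ℝ).comp_hasDerivAt t (hline t)
    -- Grönwall's inequality along the real segment `t ↦ z₁ + t • v`, on which the derivative of `w`
    -- is at most `K ‖v‖ ‖w‖`.
    have key := eq_zero_of_abs_deriv_le_mul_abs_self_of_eq_zero_right (K := K * ‖v‖)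
      (f := fun t : ℝ => fun i => w i (z₁ + t • v)) (a := 0) (b := 1)
      (fun t ht => (hder t ht).continuousAt.continuousWithinAt)
      (fun t ht => (hder t (Set.Ico_subset_Icc_self ht)).hasDerivWithinAt)
      (by funext i; simp [h1 i]) (by
        intro t ht
        obtain ⟨⟨hA', hB'⟩, hC', -⟩ := hball _ (hmem t (Set.Ico_subset_Icc_self ht))
        refine (pi_norm_le_iff_of_nonneg (by positivity)).2 fun i => ?_
        obtain ⟨v₁, v₂, v₃⟩ := v
        rw [fderiv_pt]
        set N := ‖fun i => w i (z₁ + t • (v₁, v₂, v₃))‖ with hN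
        set n := ‖((v₁, v₂, v₃) : Pt 𝕜)‖ with hn
        have n1 : ‖v₁‖ ≤ n := norm_fst_le ((v₁, v₂, v₃) : Pt 𝕜)
        have n23 : ‖((v₂, v₃) : 𝕜 × 𝕜)‖ ≤ n := norm_snd_le ((v₁, v₂, v₃) : Pt 𝕜)
        have n2 : ‖v₂‖ ≤ n := (norm_fst_le ((v₂, v₃) : 𝕜 × 𝕜)).trans n23
        have n3 : ‖v₃‖ ≤ n := (norm_snd_le ((v₂, v₃) : 𝕜 × 𝕜)).trans n23
        have n0 : 0 ≤ n := norm_nonneg _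
        have m : ∀ s d : 𝕜, ∀ k : ℝ, ‖s‖ ≤ n → ‖d‖ ≤ k * N → ‖s * d‖ ≤ n * (k * N) :=
          fun s d k hs hd => by
          rw [norm_mul]
          exact mul_le_mul hs hd (norm_nonneg _) n0
        calc _ ≤ n * (a i * N) + n * (b i * N) + n * (c i * N) :=
              (norm_add₃_le).trans (add_le_add (add_le_add (m _ _ _ n1 (hA' i))
                (m _ _ _ n2 (hB' i))) (m _ _ _ n3 (hC' i)))
          _ = (a i + b i + c i) * (n * N) := by ring
          _ ≤ K * (n * N) := mul_le_mul_of_nonneg_right (hiK i) (by positivity)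
          _ = K * n * N := by ring) 1 (by simp)
    intro i
    have := congrFun key i
    simpa [hv] using this
  -- The common zero set is open by `local_zero` and relatively closed in `U` by continuity.
  set u : Set (Pt 𝕜) := {z | z ∈ U ∧ ∀ i, w i z = 0} with hu
  have uopen : IsOpen u := by
    rw [isOpen_iff_mem_nhds]
    intro z hz
    filter_upwards [hU.mem_nhds hz.1, local_zero z hz.1 hz.2] with y h1 h2 using ⟨h1, h2⟩
  have hsub := hconn.subset_of_closure_inter_subset uopen ⟨z₀, hz₀, hz₀, h0⟩ (by
    rintro z ⟨hzc, hzU⟩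
    refine ⟨hzU, fun i => ?_⟩
    have hcont : ContinuousAt (w i) z := (hw i).continuousOn.continuousAt (hU.mem_nhds hzU)
    by_contra hne
    obtain ⟨y, hy1, hy2⟩ := mem_closure_iff_nhds.1 hzc _ (hcont.eventually_ne hne)
    exact hy1 (hy2.2 i))
  exact fun z hz => (hsub hz).2

/-! ### Symmetries are determined by ten coefficients; the dimension bound. -/

namespace System

variable {S : System 𝕜} {V : Pt 𝕜 → Pt 𝕜}

theorem IsSymmetry.eq_zero (hV : S.IsSymmetry V) (hS : S.IsSmooth) (hconn : IsPreconnected S.U)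
    (hne : ∀ z ∈ S.U, S.F2 z ≠ 0) {z₀ : Pt 𝕜} (hz₀ : z₀ ∈ S.U)
    (h0 : initialTaylorCoeffs V z₀ = 0) : ∀ z ∈ S.U, V z = 0 := by
  have hne' : ∀ z ∈ S.U, S.f2 z ≠ 0 := fun z hz => by
    rw [hS.f2_eq hz]
    exact mul_ne_zero two_ne_zero (hne z hz)
  have h := eq_zero_of_inSpan_partial hS.isOpen_U hconn (contDiffOn_frame hS.isOpen_U hV.1)
    (hV.inSpan_partial_frame hS hne') hz₀ (fun i => by rw [frame_apply, h0]; rfl)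
  exact fun z hz => Prod.ext (h z hz 0) (Prod.ext (h z hz 1) (h z hz 2))

end System

/-- The initial Taylor coefficients depend linearly on the vector field. -/
theorem initialTaylorCoeffs_comb {U : Set (Pt 𝕜)} (hU : IsOpen U) {V₁ V₂ V : Pt 𝕜 → Pt 𝕜}
    (h₁ : ContDiffOn 𝕜 ∞ V₁ U) (h₂ : ContDiffOn 𝕜 ∞ V₂ U) (a b : 𝕜)
    (hV : ∀ z ∈ U, V z = a • V₁ z + b • V₂ z) {z : Pt 𝕜} (hz : z ∈ U) :
    initialTaylorCoeffs V z = a • initialTaylorCoeffs V₁ z + b • initialTaylorCoeffs V₂ z := by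
  have der : ∀ {f f₁ f₂ : Pt 𝕜 → 𝕜} (v : Pt 𝕜), ContDiffOn 𝕜 ∞ f₁ U → ContDiffOn 𝕜 ∞ f₂ U →
      (∀ z ∈ U, f z = a * f₁ z + b * f₂ z) →
      ∀ z ∈ U, pd v f z = a * pd v f₁ z + b * pd v f₂ z := fun v c₁ c₂ e z hz => by
    rw [pd_congr hU e v hz]
    refine ((((HasAlongOn.const a).mul (hasAlongOn_pd hU c₁ v)).add
      ((HasAlongOn.const b).mul (hasAlongOn_pd hU c₂ v))) z hz).2.trans (by ring)
  have x1 := contDiffOn_xi h₁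
  have x2 := contDiffOn_xi h₂
  have t1 := contDiffOn_tau h₁
  have t2 := contDiffOn_tau h₂
  have p1 := contDiffOn_phi h₁
  have p2 := contDiffOn_phi h₂
  have x : ∀ z ∈ U, xi V z = a * xi V₁ z + b * xi V₂ z := fun z hz => by simp [xi, hV z hz]
  have t : ∀ z ∈ U, tau V z = a * tau V₁ z + b * tau V₂ z := fun z hz => by simp [tau, hV z hz]
  have p : ∀ z ∈ U, phi V z = a * phi V₁ z + b * phi V₂ z := fun z hz => by simp [phi, hV z hz]
  have xX := der (1, 0, 0) x1 x2 x
  have tX := der (1, 0, 0) t1 t2 t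
  have pX := der (1, 0, 0) p1 p2 p
  have c := fun {f : Pt 𝕜 → 𝕜} (hf : ContDiffOn 𝕜 ∞ f U) => ContDiffOn.pd hU hf (1, 0, 0)
  funext i
  fin_cases i
  exacts [x z hz, t z hz, p z hz, xX z hz, tX z hz, pX z hz, der (0, 0, 1) p1 p2 p z hz,
    der (1, 0, 0) (c x1) (c x2) xX z hz, der (1, 0, 0) (c t1) (c t2) tX z hz,
    der (1, 0, 0) (c p1) (c p2) pX z hz]

namespace System

variable {S : System 𝕜}

theorem IsSymmetry.eq_of_initialTaylorCoeffs_eq {V₁ V₂ : Pt 𝕜 → Pt 𝕜} (h₁ : S.IsSymmetry V₁)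
    (h₂ : S.IsSymmetry V₂) (hS : S.IsSmooth) (hconn : IsPreconnected S.U)
    (hne : ∀ z ∈ S.U, S.F2 z ≠ 0) {z₀ : Pt 𝕜} (hz₀ : z₀ ∈ S.U)
    (h0 : initialTaylorCoeffs V₁ z₀ = initialTaylorCoeffs V₂ z₀) : ∀ z ∈ S.U, V₁ z = V₂ z := by
  intro z hz
  have h := (h₁.comb hS.isOpen_U h₂ 1 (-1)).eq_zero hS hconn hne hz₀ (by
    rw [initialTaylorCoeffs_comb hS.isOpen_U h₁.1 h₂.1 1 (-1) (fun _ _ => rfl) hz₀, h0]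
    simp) z hz
  simpa [add_neg_eq_zero] using h

theorem rank_symmetryAlgebra_le (hS : S.IsSmooth) (hconn : IsPreconnected S.U)
    (hne : ∀ z ∈ S.U, S.F2 z ≠ 0) : Module.rank 𝕜 (S.symmetryAlgebra hS.isOpen_U) ≤ 10 := by
  have hU := hS.isOpen_U
  obtain hemp | ⟨z₀, hz₀⟩ := S.U.eq_empty_or_nonempty
  -- Without a base point there is nothing to evaluate, but the space of functions on the empty set
  -- is trivial.
  · have : IsEmpty S.U := by rw [hemp]; infer_instance
    rw [rank_subsingleton']
    exact zero_le
  -- The chosen extensions beyond `U` need not depend linearly on `v`. Their coefficients at `z₀`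
  -- do, since these depend only on the values on the open set `U`.
  choose rep hrep hrep_eq using fun v : S.symmetryAlgebra hU => v.2
  have comb : ∀ (a b : 𝕜) (v₁ v₂ v : S.symmetryAlgebra hU), v = a • v₁ + b • v₂ →
      initialTaylorCoeffs (rep v) z₀ =
        a • initialTaylorCoeffs (rep v₁) z₀ + b • initialTaylorCoeffs (rep v₂) z₀ := by
    rintro a b v₁ v₂ v rfl
    refine initialTaylorCoeffs_comb hU (hrep v₁).1 (hrep v₂).1 a b (fun z hz => ?_) hz₀
    rw [← hrep_eq _ ⟨z, hz⟩, ← hrep_eq v₁ ⟨z, hz⟩, ← hrep_eq v₂ ⟨z, hz⟩]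
    rfl
  let L : S.symmetryAlgebra hU →ₗ[𝕜] (Fin 10 → 𝕜) :=
    { toFun := fun v => initialTaylorCoeffs (rep v) z₀
      map_add' := fun v₁ v₂ => by simpa using comb 1 1 v₁ v₂ (v₁ + v₂) (by simp)
      map_smul' := fun a v => by simpa using comb a 0 v v (a • v) (by simp) }
  have hL : Function.Injective L := fun v₁ v₂ h => by
    refine Subtype.ext (funext fun z => ?_)
    rw [hrep_eq v₁ z, hrep_eq v₂ z]
    exact (hrep v₁).eq_of_initialTaylorCoeffs_eq (hrep v₂) hS hconn hne hz₀ h z z.2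
  simpa using LinearMap.rank_le_of_injective L hL

end System

end

end LieSymmetry

theorem mainTheorem1 {𝕜 : Type*} [RCLike 𝕜] (S : LieSymmetry.System 𝕜)
    (hU : IsOpen S.U) (hUconn : IsPreconnected S.U) (hW : IsOpen S.W)
    (hUW : ∀ x y u : 𝕜, (x, y, u) ∈ S.U → (x, y, u, 0) ∈ S.W)
    (hF1 : AnalyticOnNhd 𝕜 S.F1 S.U) (hF2 : AnalyticOnNhd 𝕜 S.F2 S.U)
    (hF3 : AnalyticOnNhd 𝕜 S.F3 S.W) (hG : AnalyticOnNhd 𝕜 S.G S.W)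
    (hF2ne : ∀ z ∈ S.U, S.F2 z ≠ 0) :
    (∀ V₁ V₂ : LieSymmetry.Pt 𝕜 → LieSymmetry.Pt 𝕜, S.IsSymmetry V₁ → S.IsSymmetry V₂ →
      ∀ z₀ ∈ S.U,
        LieSymmetry.initialTaylorCoeffs V₁ z₀ = LieSymmetry.initialTaylorCoeffs V₂ z₀ →
        ∀ z ∈ S.U, V₁ z = V₂ z) ∧
    Module.rank 𝕜 (S.symmetryAlgebra hU) ≤ 10 := by
  have hS : S.IsSmooth := ⟨hU, hW, fun z hz => hUW z.1 z.2.1 z.2.2 hz,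
    hF1.contDiffOn hU.uniqueDiffOn, hF2.contDiffOn hU.uniqueDiffOn,
    hF3.contDiffOn hW.uniqueDiffOn, hG.contDiffOn hW.uniqueDiffOn⟩
  exact ⟨fun _ _ h₁ h₂ _ hz₀ h0 =>
    h₁.eq_of_initialTaylorCoeffs_eq h₂ hS hUconn hF2ne hz₀ h0,
    LieSymmetry.System.rank_symmetryAlgebra_le hS hUconn hF2ne⟩
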